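/- Let $(X,d)$ be a complete separable metric space, $\mathfrak m$ a Borel measure on $X$ that is finite on bounded Borel sets, and $p\in[1,\infty)$. A curve is a continuous map $\gamma\colon[a,b]\to X$ with $a<b$; it is rectifiable if its length $\ell(\gamma)$ is finite. For Borel $\rho\colon X\to[0,\infty]$ put $\int_\gamma\rho\,ds=\int_{[a,b]}\rho\circ\gamma\,ds_\gamma$, where $s_\gamma$ is the Stieltjes measure of $t\mapsto\ell(\gamma|_{[a,t]})$, if $\gamma$ is rectifiable, and $\int_\gamma\rho\,ds=\infty$ otherwise. The $p$-modulus of a family $\Gamma$ of curves is $\mathrm{Mod}_p(\Gamma)=\inf\int_X\rho^p\,d\mathfrak m$, the infimum being over all Borel $\rho\colon X\to[0,\infty]$ with $\int_\gamma\rho\,ds\ge1$ for all $\gamma\in\Gamma$; "$\mathrm{Mod}_p$-a.e." means outside a family of zero $p$-modulus. For $f\colon X\to[-\infty,\infty]$ let $\mathrm{WUG}_N(f)$ be the set of $N$-weak $p$-upper gradients of $f$: Borel functions $\rho\colon X\to[0,\infty]$ with $\int_X\rho^p\,d\mathfrak m<\infty$ such that for $\mathrm{Mod}_p$-a.e. nonconstant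 rectifiable curve $\gamma\colon[a,b]\to X$ the values $f(\gamma_a),f(\gamma_b)$ are finite and $|f(\gamma_b)-f(\gamma_a)|\le\int_\gamma\rho\,ds$. A minimal $N$-weak $p$-upper gradient $\rho_f$ of $f$ is an element of $\mathrm{WUG}_N(f)$ of least $L^p(\mathfrak m)$-seminorm. A function is $\mathfrak m$-measurable if it is measurable for the $\mathfrak m$-completion of the Borel $\sigma$-algebra. For Lipschitz $\varphi\colon\mathbb R\to\mathbb R$ let $\mathrm{lip}(\varphi)(t)=\limsup_{s\to t}\frac{|\varphi(t)-\varphi(s)|}{|t-s|}$. Whenever $\mathrm{WUG}_N(f)\ne\varnothing$, a minimal $N$-weak $p$-upper gradient $\rho_f$ exists and is unique up to $\mathfrak m$-a.e. equality. Moreover: i) Let $f\colon X\to[-\infty,\infty]$ be $\mathfrak m$-measurable with $\mathrm{WUG}_N(f)\neq\varnothing$. Then $\rho_f=0$ $\mathfrak m$-a.e. on $\{|f|=\infty\}$, and $\rho_f=0$ $\mathfrak m$-a.e. on $f^{-1}(N)$ for every Borel set $N\subseteq\mathbb R$ with $\mathcal L^1(N)=0$. ii) (Chain rule) Let $f\colon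 X\to\mathbb R$ be $\mathfrak m$-measurable with $\mathrm{WUG}_N(f)\neq\varnothing$, and let $\varphi\colon\mathbb R\to\mathbb R$ be Lipschitz and $g=\varphi\circ f$. Then $\mathrm{WUG}_N(g)\ne\varnothing$ and $\rho_g=(\mathrm{lip}(\varphi)\circ f)\,\rho_f$ $\mathfrak m$-a.e. More generally, if $f\colon X\to[-\infty,\infty]$ is $\mathfrak m$-measurable with $\mathrm{WUG}_N(f)\neq\varnothing$, $\varphi\colon\mathbb R\to\mathbb R$ is Lipschitz, and $g=\varphi\circ f$ on $\{|f|<\infty\}$, $g=0$ on $\{|f|=\infty\}$, then $\mathrm{WUG}_N(g)\neq\varnothing$ and, $\mathfrak m$-a.e., $\rho_g=(\mathrm{lip}(\varphi)\circ f)\,\rho_f$ on $\{|f|<\infty\}$ and $\rho_g=0$ on $\{|f|=\infty\}$. iii) (Locality) Let $f,g\colon X\to[-\infty,\infty]$ be $\mathfrak m$-measurable with $\mathrm{WUG}_N(f)\neq\varnothing$ and $\mathrm{WUG}_N(g)\ne\varnothing$. Then $\mathrm{WUG}_N(f-g)\ne\varnothing$ and $\rho_{f-g}=0$ $\mathfrak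 m$-a.e. on $\{f=g\}$, whatever values are given to $f-g$ at the points where $f=g=\infty$ or $f=g=-\infty$. iv) (Leibniz rule) Let $f,g\colon X\to[-\infty,\infty]$ be $\mathfrak m$-measurable with $\mathrm{WUG}_N(f)\neq\varnothing$ and $\mathrm{WUG}_N(g)\neq\varnothing$, and suppose that $|f|+|g|\le C$ $\mathfrak m$-a.e. for some constant $C\in\mathbb R$. Then $\mathrm{WUG}_N(fg)\neq\varnothing$ and $\rho_{fg}\le|f|\rho_g+|g|\rho_f$ $\mathfrak m$-a.e. (with the convention $0\cdot\infty=0$). -/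

import Mathlib

open MeasureTheory Set Filter Topology
open scoped ENNReal

/-- A curve in `X`: a continuous map from a compact interval `[a, b]`, `a < b`, into `X`. -/
structure PathCurve (X : Type*) [TopologicalSpace X] where
  a : ℝ
  b : ℝ
  lt : a < b
  toMap : C(Set.Icc a b, X)

namespace PathCurve

section Topological

variable {X : Type*} [TopologicalSpace X]

/-- The initial point `γ(a)`. -/
def source (γ : PathCurve X) : X := γ.toMap ⟨γ.a, left_mem_Icc.2 γ.lt.le⟩

/-- The final point `γ(b)`. -/
def target (γ : PathCurve X) : X := γ.toMap ⟨γ.b, right_mem_Icc.2 γ.lt.le⟩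

/-- A curve is nonconstant if its image is not a single point. -/
def Nonconstant (γ : PathCurve X) : Prop := ∃ s t, γ.toMap s ≠ γ.toMap t

/-- The extension of `γ` to `ℝ` that is constant on `(-∞, a]` and on `[b, ∞)`. -/
noncomputable def ext (γ : PathCurve X) : ℝ → X := Set.IccExtend γ.lt.le γ.toMap

theorem continuous_ext (γ : PathCurve X) : Continuous γ.ext :=
  γ.toMap.continuous.Icc_extend'

end Topological

section Metric

variable {X : Type*} [MetricSpace X]

/-- The length of `γ`: the supremum of its variations over all partitions of `[a, b]`. -/
noncomputable def length (γ : PathCurve X) : ℝ≥0∞ := eVariationOn γ.toMap Set.univ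

/-- A curve is rectifiable if it has finite length. -/
def Rectifiable (γ : PathCurve X) : Prop := γ.length ≠ ∞

theorem Rectifiable.boundedVariationOn_ext {γ : PathCurve X} (h : γ.Rectifiable) :
    BoundedVariationOn γ.ext Set.univ :=
  ne_top_of_le_ne_top h
    (eVariationOn.comp_le_of_monotoneOn γ.toMap (t := Set.univ) (s := Set.univ)
      (Set.projIcc γ.a γ.b γ.lt.le) ((Set.monotone_projIcc γ.lt.le).monotoneOn _)
      (Set.mapsTo_univ _ _))

/-- The arc length function `t ↦ ℓ(γ|_{[a, t]})` of a rectifiable curve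
(extended to `ℝ` by `0` on `(-∞, a]` and by `ℓ(γ)` on `[b, ∞)`). -/
noncomputable def arcLength (γ : PathCurve X) (h : γ.Rectifiable) : StieltjesFunction ℝ where
  toFun t := variationOnFromTo γ.ext Set.univ γ.a t
  mono' := by
    rw [← monotoneOn_univ]
    exact variationOnFromTo.monotoneOn h.boundedVariationOn_ext.locallyBoundedVariationOn
      (Set.mem_univ _)
  right_continuous' _ :=
    h.boundedVariationOn_ext.continuousWithinAt_variationOnFromTo_Ici
      γ.continuous_ext.continuousWithinAt

/-- The total variation measure `s_γ` of a rectifiable curve `γ`: the Lebesgue--Stieltjes measure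
of its arc length function. It is carried by `[a, b]`. -/
noncomputable def lengthMeasure (γ : PathCurve X) (h : γ.Rectifiable) : Measure ℝ :=
  (γ.arcLength h).measure

open scoped Classical in
/-- The path integral `∫_γ ρ ds`; it is `∞` by convention if `γ` is not rectifiable. -/
noncomputable def pathIntegral (ρ : X → ℝ≥0∞) (γ : PathCurve X) : ℝ≥0∞ :=
  if h : γ.Rectifiable then ∫⁻ t in Set.Icc γ.a γ.b, ρ (γ.ext t) ∂(γ.lengthMeasure h) else ∞

end Metric

end PathCurve

section Sobolev

variable {X : Type*} [MetricSpace X] [MeasurableSpace X]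

/-- A measure on a metric space is boundedly finite if bounded measurable sets have
finite measure. -/
def IsBoundedlyFiniteMeasure (m : Measure X) : Prop :=
  ∀ B : Set X, MeasurableSet B → Bornology.IsBounded B → m B < ∞

/-- Admissible functions of a curve family: Borel `ρ : X → [0, ∞]` with `∫_γ ρ ds ≥ 1` for every
`γ ∈ Γ`. -/
def IsAdmissible (Γ : Set (PathCurve X)) (ρ : X → ℝ≥0∞) : Prop :=
  Measurable ρ ∧ ∀ γ ∈ Γ, 1 ≤ γ.pathIntegral ρ

/-- The `p`-modulus of a curve family. -/
noncomputable def pModulus (m : Measure X) (p : ℝ) (Γ : Set (PathCurve X)) : ℝ≥0∞ :=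
  ⨅ (ρ : X → ℝ≥0∞) (_ : IsAdmissible Γ ρ), ∫⁻ x, ρ x ^ p ∂m

/-- `P` holds for `Mod_p`-almost every nonconstant rectifiable curve. -/
def ForModAECurve (m : Measure X) (p : ℝ) (P : PathCurve X → Prop) : Prop :=
  pModulus m p {γ | γ.Rectifiable ∧ γ.Nonconstant ∧ ¬ P γ} = 0

/-- The set `WUG_N(f)` of `N`-weak `p`-upper gradients of `f : X → [-∞, ∞]`: Borel, `p`-integrable
`ρ : X → [0, ∞]` such that, for `Mod_p`-a.e. nonconstant rectifiable curve, `f` is finite at both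
end points and `|f(γ_b) - f(γ_a)| ≤ ∫_γ ρ ds`. -/
def WUG (m : Measure X) (p : ℝ) (f : X → EReal) : Set (X → ℝ≥0∞) :=
  {ρ | Measurable ρ ∧ ∫⁻ x, ρ x ^ p ∂m < ∞ ∧
    ForModAECurve m p (fun γ => (f γ.source).abs < ∞ ∧ (f γ.target).abs < ∞) ∧
    ForModAECurve m p (fun γ => (f γ.target - f γ.source).abs ≤ γ.pathIntegral ρ)}

/-- `ρ` is a minimal `N`-weak `p`-upper gradient `ρ_f` of `f`: an element of `WUG_N(f)` of minimal
`L^p`-seminorm. -/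
def IsMinimalWUG (m : Measure X) (p : ℝ) (f : X → EReal) (ρ : X → ℝ≥0∞) : Prop :=
  ρ ∈ WUG m p f ∧
    ∀ ρ' ∈ WUG m p f, (∫⁻ x, ρ x ^ p ∂m) ^ (1 / p) ≤ (∫⁻ x, ρ' x ^ p ∂m) ^ (1 / p)

end Sobolev

/-- The slope `lip(φ)(t) = limsup_{s → t} |φ(t) - φ(s)| / |t - s|` of `φ : ℝ → ℝ`. -/
noncomputable def lipSlope (φ : ℝ → ℝ) (t : ℝ) : ℝ≥0∞ :=
  limsup (fun s => edist (φ t) (φ s) / edist t s) (𝓝[≠] t)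

open scoped Classical in
/-- The extension of `φ : ℝ → ℝ` to `[-∞, ∞]` that takes the value `0` at `±∞`. -/
noncomputable def extendZero (φ : ℝ → ℝ) (y : EReal) : EReal :=
  if y = ⊤ ∨ y = ⊥ then 0 else ((φ y.toReal : ℝ) : EReal)

/-! Along a rectifiable curve γ with arc length measure μ, the function F = f ∘ γ is studied through
its density θ, that is, F(t) − F(s) = ∫_{(s,t]} θ dμ. By `mem_WUG_iff`, a p-integrable Borel ρ is a
weak upper gradient exactly when, along almost every curve, f is finite, F has a density, and |θ| ≤
ρ ∘ γ holds μ-a.e. No reparametrization is needed, since all the calculus takes place in the measure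
μ, which is finite and has no atoms.

Densities are unique a.e., so weak upper gradients are stable under countable infima. The infimum of
a minimizing sequence is therefore minimal, for p = 1 as well, and minimality of the norm becomes
minimality m-a.e. Moreover (`IsMinimalWUG.ae_le_of_derivBound`) ρ_f lies below every m-measurable σ
that bounds θ along almost every curve, even if σ is not integrable or takes the value ∞.

Each assertion is thereby a fact about θ. The change of variables `HasDensity.integral_comp_mul`
yields θ = 0 on preimages of null sets and the Lipschitz chain rule; polarization yields the product
rule. Vanishing of ρ_f on a set is tested with a σ that is 0 there and ∞ elsewhere. The chain rule
needs a bound in each direction: |φ'(f)| ρ_f bounds the derivative of g, and ρ_g / |φ'(f)| bounds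
that of f where φ'(f) ≠ 0. Points where φ is not differentiable form a null set and are absorbed by
the vanishing statement. -/

/-! ### Calculus of densities with respect to a measure on the line -/

/-- `F : ℝ → ℝ` is absolutely continuous with respect to `μ`, with density `θ`. -/
structure HasDensity (μ : Measure ℝ) (F θ : ℝ → ℝ) : Prop where
  integrable : Integrable θ μ
  sub_eq : ∀ s t, s ≤ t → F t - F s = ∫ r in Ioc s t, θ r ∂μ

namespace HasDensity

variable {μ : Measure ℝ} {F G θ ϑ : ℝ → ℝ}

theorem congr (h : HasDensity μ F θ) (hθ : θ =ᵐ[μ] ϑ) : HasDensity μ F ϑ :=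
  ⟨h.integrable.congr hθ, fun s t hst => by
    rw [h.sub_eq s t hst]; exact integral_congr_ae (ae_restrict_of_ae hθ)⟩

theorem add (h : HasDensity μ F θ) (h' : HasDensity μ G ϑ) :
    HasDensity μ (fun t => F t + G t) (fun t => θ t + ϑ t) :=
  ⟨h.integrable.add h'.integrable, fun s t hst => by
    rw [integral_add h.integrable.integrableOn h'.integrable.integrableOn, ← h.sub_eq s t hst,
      ← h'.sub_eq s t hst]; ring⟩

theorem const_mul (c : ℝ) (h : HasDensity μ F θ) :
    HasDensity μ (fun t => c * F t) (fun t => c * θ t) :=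
  ⟨h.integrable.const_mul c, fun s t hst => by
    rw [integral_const_mul, ← h.sub_eq s t hst]; ring⟩

theorem sub (h : HasDensity μ F θ) (h' : HasDensity μ G ϑ) :
    HasDensity μ (fun t => F t - G t) (fun t => θ t - ϑ t) := by
  simpa [sub_eq_add_neg] using h.add (h'.const_mul (-1))

theorem ofReal_abs_sub_le (h : HasDensity μ F θ) {s t : ℝ} (hst : s ≤ t) :
    ENNReal.ofReal |F t - F s| ≤ ∫⁻ r in Ioc s t, ENNReal.ofReal |θ r| ∂μ := by
  rw [h.sub_eq s t hst]
  simpa [← Real.enorm_eq_ofReal_abs] using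
    enorm_integral_le_lintegral_enorm (μ := μ.restrict (Ioc s t)) θ

theorem abs_sub_le (h : HasDensity μ F θ) (s t : ℝ) : |F t - F s| ≤ ∫ r, |θ r| ∂μ := by
  wlog hst : s ≤ t generalizing s t
  · rw [abs_sub_comm]; exact this t s (le_of_not_ge hst)
  rw [h.sub_eq s t hst]
  refine (abs_integral_le_integral_abs).trans ?_
  exact setIntegral_le_integral h.integrable.abs (Eventually.of_forall fun _ => abs_nonneg _)

theorem continuous [IsFiniteMeasure μ] [NullSingletonClass μ] (h : HasDensity μ F θ) : Continuous F := by
  have hF : F = fun t => F 0 + ∫ r in (0 : ℝ)..t, θ r ∂μ := by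
    funext t
    rcases le_total 0 t with ht | ht
    · rw [intervalIntegral.integral_of_le ht, ← h.sub_eq 0 t ht]; ring
    · rw [intervalIntegral.integral_of_ge ht, ← h.sub_eq t 0 ht]; ring
  rw [hF]
  exact continuous_const.add
    (intervalIntegral.continuous_primitive (fun a b => h.integrable.intervalIntegrable) 0)

/-- A density is determined up to a null set. -/
theorem ae_eq [IsFiniteMeasure μ] (h : HasDensity μ F θ) (h' : HasDensity μ F ϑ) :
    θ =ᵐ[μ] ϑ := by
  have hd : Integrable (fun t => θ t - ϑ t) μ := h.integrable.sub h'.integrable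
  have hz : ∀ s t, s ≤ t → ∫ r in Ioc s t, (θ r - ϑ r) ∂μ = 0 := fun s t hst => by
    rw [integral_sub h.integrable.integrableOn h'.integrable.integrableOn, ← h.sub_eq s t hst,
      ← h'.sub_eq s t hst, sub_self]
  set d := fun t => θ t - ϑ t
  have hm : AEMeasurable d μ := hd.aemeasurable
  have hfin : ∀ e : ℝ → ℝ, Integrable e μ → ∫⁻ r, ENNReal.ofReal (e r) ∂μ ≠ ∞ := fun e he =>
    ((lintegral_mono fun r => Real.ofReal_le_enorm (e r)).trans_lt he.2).ne
  have hfin1 := hfin d hd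
  have hfin2 := hfin (fun t => -d t) hd.neg
  have : IsFiniteMeasure (μ.withDensity fun r => ENNReal.ofReal (d r)) :=
    isFiniteMeasure_withDensity hfin1
  -- The positive and negative parts of d define finite measures that agree on all intervals (s, t],
  -- so the two parts are a.e. equal. As one of them is always 0, both are.
  have key : (μ.withDensity fun r => ENNReal.ofReal (d r)) =
      μ.withDensity fun r => ENNReal.ofReal (-d r) := by
    refine Measure.ext_of_Ioc _ _ fun s t hst => ?_
    rw [withDensity_apply _ measurableSet_Ioc, withDensity_apply _ measurableSet_Ioc]
    have := hz s t hst.le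
    rw [integral_eq_lintegral_pos_part_sub_lintegral_neg_part hd.integrableOn, sub_eq_zero] at this
    refine (ENNReal.toReal_eq_toReal_iff' ?_ ?_).1 this
    · exact ne_top_of_le_ne_top hfin1 (setLIntegral_le_lintegral _ _)
    · exact ne_top_of_le_ne_top hfin2 (setLIntegral_le_lintegral _ _)
  have hm' : AEMeasurable (fun t => -d t) μ := hm.neg
  rw [withDensity_eq_iff hm.ennreal_ofReal hm'.ennreal_ofReal hfin1] at key
  filter_upwards [key] with t ht
  have : d t = 0 := by
    rcases le_total 0 (d t) with h0 | h0
    · rw [ENNReal.ofReal_of_nonpos (neg_nonpos.2 h0), ENNReal.ofReal_eq_zero] at ht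
      exact le_antisymm ht h0
    · rw [ENNReal.ofReal_of_nonpos h0, eq_comm, ENNReal.ofReal_eq_zero] at ht
      linarith
  exact sub_eq_zero.1 this

/-- A function whose increments are controlled by the integrals of `r` has a density bounded
by `r`. -/
theorem exists_of_le [IsFiniteMeasure μ] [NullSingletonClass μ] {r : ℝ → ℝ≥0∞} (hr : Measurable r)
    (hfin : ∫⁻ t, r t ∂μ ≠ ∞)
    (hF : ∀ s t, s ≤ t → ENNReal.ofReal |F t - F s| ≤ ∫⁻ u in Ioc s t, r u ∂μ) :
    ∃ θ, HasDensity μ F θ ∧ ∀ᵐ t ∂μ, ENNReal.ofReal |θ t| ≤ r t := by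
  have hri : Integrable (fun t => (r t).toReal) μ :=
    integrable_toReal_of_lintegral_ne_top hr.aemeasurable hfin
  set M : ℝ → ℝ := fun t => ∫ u in (0 : ℝ)..t, (r u).toReal ∂μ with hMdef
  have hM : ∀ s t, s ≤ t → M t - M s = ∫ u in Ioc s t, (r u).toReal ∂μ := fun s t hst => by
    rw [← intervalIntegral.integral_of_le hst]
    exact intervalIntegral.integral_interval_sub_left hri.intervalIntegrable hri.intervalIntegrable
  have hMd : HasDensity μ M (fun t => (r t).toReal) := ⟨hri, hM⟩
  have hMl : ∀ s t, s ≤ t → ENNReal.ofReal (M t - M s) = ∫⁻ u in Ioc s t, r u ∂μ := by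
    intro s t hst
    have hne : ∫⁻ u in Ioc s t, r u ∂μ ≠ ∞ :=
      ne_top_of_le_ne_top hfin (setLIntegral_le_lintegral _ _)
    rw [hM s t hst, integral_toReal hr.aemeasurable (ae_lt_top hr hne), ENNReal.ofReal_toReal hne]
  have hFM : ∀ s t, s ≤ t → |F t - F s| ≤ M t - M s := fun s t hst => by
    have h0 : 0 ≤ M t - M s := by
      rw [hM s t hst]; exact integral_nonneg fun _ => ENNReal.toReal_nonneg
    have := hF s t hst
    rwa [← hMl s t hst, ENNReal.ofReal_le_ofReal_iff h0] at this
  have hMc : Continuous M := hMd.continuous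
  have hFc : Continuous F := by
    rw [continuous_iff_continuousAt]
    intro x
    rw [ContinuousAt, tendsto_iff_dist_tendsto_zero]
    have : Tendsto (fun y => dist (M y) (M x)) (𝓝 x) (𝓝 0) :=
      tendsto_iff_dist_tendsto_zero.1 (hMc.tendsto x)
    refine squeeze_zero (fun _ => dist_nonneg) (fun y => ?_) this
    rw [Real.dist_eq, Real.dist_eq]
    rcases le_total x y with h | h
    · exact (hFM x y h).trans (le_abs_self _)
    · rw [abs_sub_comm, abs_sub_comm (M y)]
      exact (hFM y x h).trans (le_abs_self _)
  -- Signed measures are avoided: M + F and M − F are both nondecreasing, and their Stieltjes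
  -- measures add up to 2rμ. Both are thus absolutely continuous, with derivatives g and g'
  -- satisfying g + g' = 2r. Then (g − g')/2 is a density of F and is at most r in absolute value.
  let S (G : ℝ → ℝ) (hG : Continuous G) (hm : Monotone G) : StieltjesFunction ℝ :=
    ⟨G, hm, fun x => hG.continuousWithinAt⟩
  have hpm : Monotone fun t => M t + F t := fun s t hst => by
    have := (abs_le.1 (hFM s t hst)).1; simp only; linarith
  have hmm : Monotone fun t => M t - F t := fun s t hst => by
    have := (abs_le.1 (hFM s t hst)).2; simp only; linarith
  set ν := (S _ (hMc.add hFc) hpm).measure with hν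
  set ν' := (S _ (hMc.sub hFc) hmm).measure with hν'
  have hν_Ioc : ∀ s t, ν (Ioc s t) = ENNReal.ofReal ((M t + F t) - (M s + F s)) := fun s t =>
    StieltjesFunction.measure_Ioc _ _ _
  have hν'_Ioc : ∀ s t, ν' (Ioc s t) = ENNReal.ofReal ((M t - F t) - (M s - F s)) := fun s t =>
    StieltjesFunction.measure_Ioc _ _ _
  have hfin2 : ∫⁻ t, 2 * r t ∂μ ≠ ∞ := by
    rw [lintegral_const_mul _ hr]; exact ENNReal.mul_ne_top (by simp) hfin
  have := isFiniteMeasure_withDensity hfin2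
  have hsum : ν + ν' = μ.withDensity fun t => 2 * r t := by
    symm
    refine Measure.ext_of_Ioc _ _ fun s t hst => ?_
    symm
    rw [Measure.add_apply, hν_Ioc, hν'_Ioc, withDensity_apply _ measurableSet_Ioc,
      lintegral_const_mul _ hr, ← hMl s t hst.le, ← ENNReal.ofReal_add
        (sub_nonneg.2 (hpm hst.le)) (sub_nonneg.2 (hmm hst.le)),
      show (2 : ℝ≥0∞) = ENNReal.ofReal 2 by simp, ← ENNReal.ofReal_mul (by norm_num)]
    congr 1; ring
  have : IsFiniteMeasure (ν + ν') := hsum ▸ isFiniteMeasure_withDensity hfin2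
  have : IsFiniteMeasure ν := isFiniteMeasure_of_le (ν + ν') (Measure.le_add_right le_rfl)
  have : IsFiniteMeasure ν' := isFiniteMeasure_of_le (ν + ν') (Measure.le_add_left le_rfl)
  have hac : ν + ν' ≪ μ := hsum ▸ withDensity_absolutelyContinuous _ _
  have hac1 : ν ≪ μ := (Measure.absolutelyContinuous_of_le (Measure.le_add_right le_rfl)).trans hac
  have hac2 : ν' ≪ μ := (Measure.absolutelyContinuous_of_le (Measure.le_add_left le_rfl)).trans hac
  set g := ν.rnDeriv μ with hg
  set g' := ν'.rnDeriv μ with hg'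
  have hgν : μ.withDensity g = ν := Measure.withDensity_rnDeriv_eq _ _ hac1
  have hgν' : μ.withDensity g' = ν' := Measure.withDensity_rnDeriv_eq _ _ hac2
  have hgm : Measurable g := Measure.measurable_rnDeriv _ _
  have hgm' : Measurable g' := Measure.measurable_rnDeriv _ _
  have hgg : (fun t => g t + g' t) =ᵐ[μ] fun t => 2 * r t := by
    change g + g' =ᵐ[μ] _
    rw [← withDensity_eq_iff (hgm.add hgm').aemeasurable (hr.const_mul 2).aemeasurable]
    · rw [← hsum, withDensity_add_left hgm, hgν, hgν']
    · change ∫⁻ t, g t + g' t ∂μ ≠ ∞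
      rw [lintegral_add_left hgm]
      exact ENNReal.add_ne_top.2 ⟨(Measure.lintegral_rnDeriv_lt_top ν μ).ne,
        (Measure.lintegral_rnDeriv_lt_top ν' μ).ne⟩
  have hgd : HasDensity μ (fun t => M t + F t) (fun t => (g t).toReal) :=
    ⟨Measure.integrable_toReal_rnDeriv, fun s t hst => by
      rw [Measure.setIntegral_toReal_rnDeriv hac1, measureReal_def, hν_Ioc,
        ENNReal.toReal_ofReal (sub_nonneg.2 (hpm hst))]⟩
  have hgd' : HasDensity μ (fun t => M t - F t) (fun t => (g' t).toReal) :=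
    ⟨Measure.integrable_toReal_rnDeriv, fun s t hst => by
      rw [Measure.setIntegral_toReal_rnDeriv hac2, measureReal_def, hν'_Ioc,
        ENNReal.toReal_ofReal (sub_nonneg.2 (hmm hst))]⟩
  refine ⟨fun t => (1 / 2) * ((g t).toReal - (g' t).toReal), ?_, ?_⟩
  · have := (hgd.sub hgd').const_mul (1 / 2)
    convert this using 2 with t
    ring
  · filter_upwards [hgg, Measure.rnDeriv_lt_top ν μ, Measure.rnDeriv_lt_top ν' μ] with t ht h1 h2
    have h3 : r t ≠ ∞ := by
      intro h
      rw [h, ENNReal.mul_top (by simp)] at ht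
      exact (ENNReal.add_lt_top.2 ⟨h1, h2⟩).ne ht
    rw [← ENNReal.ofReal_toReal h3]
    refine ENNReal.ofReal_le_ofReal ?_
    have h4 := congrArg ENNReal.toReal ht
    rw [ENNReal.toReal_add h1.ne h2.ne, ENNReal.toReal_mul] at h4
    have h5 : 0 ≤ (g t).toReal := ENNReal.toReal_nonneg
    have h6 : 0 ≤ (g' t).toReal := ENNReal.toReal_nonneg
    have h7 : (2 : ℝ≥0∞).toReal = 2 := by simp
    rw [h7] at h4
    rw [abs_le]
    constructor <;> linarith

/-- If `φ' ∘ F` oscillates by at most `ε` on `[u, v]`, then the error in the chain rule is at most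
`ε` times the total variation of `F`. -/
theorem abs_comp_sub_le [IsFiniteMeasure μ] [NullSingletonClass μ] (h : HasDensity μ F θ)
    {φ η : ℝ → ℝ} (hφ : ∀ y, HasDerivAt φ (η y) y) {u v ε : ℝ} (huv : u ≤ v)
    (hint : Integrable (fun r => η (F r) * θ r) μ)
    (hε : ∀ x ∈ Icc u v, ∀ y ∈ Icc u v, |η (F x) - η (F y)| ≤ ε) :
    |φ (F v) - φ (F u) - ∫ r in Ioc u v, η (F r) * θ r ∂μ| ≤ ε * ∫ r in Ioc u v, |θ r| ∂μ := by
  have hFc := h.continuous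
  -- The mean value theorem gives an intermediate value c between F(u) and F(v); continuity of F
  -- realizes c as F(w) with w in [u, v], where the oscillation bound applies.
  obtain ⟨w, hw, hweq⟩ : ∃ w ∈ Icc u v, φ (F v) - φ (F u) = η (F w) * (F v - F u) := by
    have main : ∀ x y, x < y → ∃ c ∈ Icc x y, φ y - φ x = η c * (y - x) := fun x y hxy => by
      obtain ⟨c, hc, hc'⟩ := exists_hasDerivAt_eq_slope φ η hxy
        (fun z _ => (hφ z).continuousAt.continuousWithinAt) (fun z _ => hφ z)
      refine ⟨c, Ioo_subset_Icc_self hc, ?_⟩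
      rw [hc', div_mul_cancel₀ _ (sub_pos.2 hxy).ne']
    rcases lt_trichotomy (F u) (F v) with h1 | h1 | h1
    · obtain ⟨c, hc, hc'⟩ := main _ _ h1
      obtain ⟨w, hw, rfl⟩ := intermediate_value_Icc huv hFc.continuousOn hc
      exact ⟨w, hw, hc'⟩
    · exact ⟨u, left_mem_Icc.2 huv, by simp [h1]⟩
    · obtain ⟨c, hc, hc'⟩ := main _ _ h1
      obtain ⟨w, hw, rfl⟩ := intermediate_value_Icc' huv hFc.continuousOn hc
      exact ⟨w, hw, by linarith⟩
  rw [hweq, h.sub_eq u v huv, ← integral_const_mul, ← integral_sub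
    (h.integrable.integrableOn.const_mul _) hint.integrableOn, ← integral_const_mul]
  refine abs_integral_le_integral_abs.trans ?_
  refine setIntegral_mono_on ((h.integrable.const_mul _).sub hint).abs.integrableOn
    (h.integrable.abs.const_mul _).integrableOn measurableSet_Ioc fun r hr => ?_
  rw [← sub_mul, abs_mul]
  exact mul_le_mul_of_nonneg_right (hε w hw r (Ioc_subset_Icc_self hr)) (abs_nonneg _)

/-- F stays within ∫|θ| dμ of F(0), hence in a compact set, on which η is bounded. -/
theorem integrable_comp_mul (h : HasDensity μ F θ) (hFc : Continuous F) {η : ℝ → ℝ}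
    (hη : Continuous η) : Integrable (fun r => η (F r) * θ r) μ := by
  obtain ⟨C, hC⟩ := (isCompact_closedBall (F 0) (∫ r, |θ r| ∂μ)).exists_bound_of_continuousOn
    hη.continuousOn
  refine h.integrable.bdd_mul (c := C) (hη.comp hFc).aestronglyMeasurable
    (Eventually.of_forall fun r => hC _ ?_)
  rw [Metric.mem_closedBall, Real.dist_eq]
  exact h.abs_sub_le 0 r

/-- The chain rule for outer functions of class `C¹`. -/
theorem comp_contDiff [IsFiniteMeasure μ] [NullSingletonClass μ] (h : HasDensity μ F θ)
    {φ η : ℝ → ℝ} (hφ : ∀ y, HasDerivAt φ (η y) y) (hη : Continuous η) :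
    HasDensity μ (fun t => φ (F t)) (fun t => η (F t) * θ t) := by
  have hFc := h.continuous
  have hint := h.integrable_comp_mul hFc hη
  refine ⟨hint, fun s t hst => ?_⟩
  set K := ∫ r in Ioc s t, |θ r| ∂μ with hK
  have hK0 : 0 ≤ K := integral_nonneg fun _ => abs_nonneg _
  suffices H : ∀ ε > 0, |φ (F t) - φ (F s) - ∫ r in Ioc s t, η (F r) * θ r ∂μ| ≤ ε * K by
    have h0 : |φ (F t) - φ (F s) - ∫ r in Ioc s t, η (F r) * θ r ∂μ| ≤ 0 := by
      refine le_of_forall_pos_le_add fun ε hε => ?_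
      -- The variation K may be 0, hence K + 1 in the denominator.
      refine (H (ε / (K + 1)) (by positivity)).trans ?_
      rw [zero_add, div_mul_eq_mul_div, div_le_iff₀ (by positivity)]
      nlinarith
    exact sub_eq_zero.1 (abs_nonpos_iff.1 h0)
  intro ε hε
  have huc : UniformContinuousOn (fun x => η (F x)) (Icc s t) :=
    isCompact_Icc.uniformContinuousOn_of_continuous (hη.comp hFc).continuousOn
  obtain ⟨δ, hδ, hδε⟩ := Metric.uniformContinuousOn_iff.1 huc ε hε
  -- Splitting [s, t] into n equal pieces makes the mesh smaller than δ, so η ∘ F oscillates by less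
  -- than ε on each piece; the errors then add up to at most εK.
  obtain ⟨n, hn⟩ := exists_nat_gt ((t - s) / δ)
  have hn0 : 0 < (n : ℝ) := lt_of_le_of_lt (div_nonneg (sub_nonneg.2 hst) hδ.le) hn
  set x : ℕ → ℝ := fun i => s + i * ((t - s) / n) with hx
  have hstep : (t - s) / n < δ := by
    rw [div_lt_iff₀ hδ] at hn; rw [div_lt_iff₀ hn0]; linarith
  have hstep0 : 0 ≤ (t - s) / n := div_nonneg (sub_nonneg.2 hst) hn0.le
  have hxmono : Monotone x := fun i j hij => by
    have : (i : ℝ) ≤ j := by exact_mod_cast hij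
    simp only [hx]; gcongr
  have hx0 : x 0 = s := by simp [hx]
  have hxn : x n = t := by simp only [hx]; field_simp; ring
  have hadd : ∀ e : ℝ → ℝ, Integrable e μ →
      ∑ i ∈ Finset.range n, ∫ r in Ioc (x i) (x (i + 1)), e r ∂μ = ∫ r in Ioc s t, e r ∂μ := by
    intro e he
    rw [← intervalIntegral.integral_of_le hst, ← hx0, ← hxn,
      ← intervalIntegral.sum_integral_adjacent_intervals fun k _ => he.intervalIntegrable]
    exact Finset.sum_congr rfl fun i _ =>
      (intervalIntegral.integral_of_le (hxmono (Nat.le_succ i))).symm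
  have htel : φ (F t) - φ (F s) = ∑ i ∈ Finset.range n, (φ (F (x (i + 1))) - φ (F (x i))) := by
    rw [Finset.sum_range_sub fun i => φ (F (x i)), hx0, hxn]
  rw [htel, ← hadd _ hint, hK, ← hadd _ h.integrable.abs, ← Finset.sum_sub_distrib, Finset.mul_sum]
  refine (Finset.abs_sum_le_sum_abs _ _).trans (Finset.sum_le_sum fun i hi => ?_)
  have hi' : i + 1 ≤ n := Finset.mem_range.1 hi
  have hsub : Icc (x i) (x (i + 1)) ⊆ Icc s t :=
    Icc_subset_Icc (hx0 ▸ hxmono (Nat.zero_le i)) (hxn ▸ hxmono hi')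
  refine h.abs_comp_sub_le hφ (hxmono (Nat.le_succ i)) hint fun y hy z hz => ?_
  have hd : dist y z < δ := by
    refine (Real.dist_le_of_mem_Icc hy hz).trans_lt ?_
    have : x (i + 1) - x i = (t - s) / n := by simp only [hx]; push_cast; ring
    rwa [this]
  exact (hδε y (hsub hy) z (hsub hz) hd).le

/-- Polarization, FG = ((F + G)² − (F − G)²)/4, reduces this to the chain rule for the square. -/
theorem mul [IsFiniteMeasure μ] [NullSingletonClass μ] (h : HasDensity μ F θ)
    (h' : HasDensity μ G ϑ) :
    HasDensity μ (fun t => F t * G t) (fun t => F t * ϑ t + G t * θ t) := by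
  have hsq : ∀ {H κ : ℝ → ℝ}, HasDensity μ H κ →
      HasDensity μ (fun t => H t ^ 2) (fun t => 2 * H t * κ t) := fun hH =>
    hH.comp_contDiff (φ := fun y => y ^ 2) (η := fun y => 2 * y)
      (fun y => by simpa using hasDerivAt_pow 2 y) (by fun_prop)
  have := ((hsq (h.add h')).sub (hsq (h.sub h'))).const_mul (1 / 4)
  convert this using 2 <;> ring

/-- Change of variables: `∫_{F s}^{F t} η = ∫_{(s, t]} (η ∘ F) θ dμ` for bounded Borel `η`. -/
theorem integral_comp_mul [IsFiniteMeasure μ] [NullSingletonClass μ] (h : HasDensity μ F θ)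
    {η : ℝ → ℝ} (hη : Measurable η) {C : ℝ} (hC : ∀ y, |η y| ≤ C) {s t : ℝ} (hst : s ≤ t) :
    ∫ y in F s..F t, η y = ∫ r in Ioc s t, η (F r) * θ r ∂μ := by
  have hFc := h.continuous
  wlog hθm : Measurable θ generalizing θ
  · obtain ⟨θ', hθ', hθθ'⟩ := h.integrable.1.aemeasurable
    rw [this (h.congr hθθ') hθ']
    refine integral_congr_ae (ae_restrict_of_ae ?_)
    filter_upwards [hθθ'] with r hr using by rw [hr]
  have hfin : ∀ e : ℝ → ℝ, Integrable e μ →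
      IsFiniteMeasure ((μ.restrict (Ioc s t)).withDensity fun r => ENNReal.ofReal (e r)) :=
    fun e he => isFiniteMeasure_withDensity
      ((lintegral_mono fun r => Real.ofReal_le_enorm (e r)).trans_lt he.integrableOn.2).ne
  have := hfin _ h.integrable
  have := hfin _ h.integrable.neg
  set κ₁ := (μ.restrict (Ioc s t)).withDensity fun r => ENNReal.ofReal (θ r)
  set κ₂ := (μ.restrict (Ioc s t)).withDensity fun r => ENNReal.ofReal ((-θ) r)
  -- The claim is that the image of θμ under F is oriented Lebesgue measure from F(s) to F(t).
  -- Moving the negative parts across makes it an equality of two finite positive measures; one of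
  -- the two Lebesgue terms is always 0.
  set P₁ := κ₁.map F + volume.restrict (Ioc (F t) (F s)) with hP₁
  set P₂ := κ₂.map F + volume.restrict (Ioc (F s) (F t)) with hP₂
  have hbi : ∀ e : ℝ → ℝ, Measurable e → ∀ B : ℝ, (∀ y, |e y| ≤ B) → ∀ (Q : Measure ℝ)
      [IsFiniteMeasure Q], Integrable e Q := fun e he B hB Q _ =>
    Integrable.of_bound he.aestronglyMeasurable B (Eventually.of_forall hB)
  have hdiff : ∀ e : ℝ → ℝ, Measurable e → ∀ B : ℝ, (∀ y, |e y| ≤ B) →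
      ∫ y, e y ∂P₁ - ∫ y, e y ∂P₂ =
        ∫ r in Ioc s t, e (F r) * θ r ∂μ - ∫ y in F s..F t, e y := by
    intro e he B hB
    have h1 : ∀ d : ℝ → ℝ, Measurable d → Integrable d μ →
        ∫ y, e (F y) ∂((μ.restrict (Ioc s t)).withDensity fun r => ENNReal.ofReal (d r)) =
          ∫ r in Ioc s t, max (d r) 0 * e (F r) ∂μ := fun d hd _ => by
      rw [integral_withDensity_eq_integral_toReal_smul (by fun_prop)
        (Eventually.of_forall fun _ => ENNReal.ofReal_lt_top)]
      simp [ENNReal.toReal_ofReal']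
    rw [hP₁, hP₂, integral_add_measure (hbi e he B hB _) (hbi e he B hB _),
      integral_add_measure (hbi e he B hB _) (hbi e he B hB _),
      integral_map hFc.measurable.aemeasurable he.aestronglyMeasurable,
      integral_map hFc.measurable.aemeasurable he.aestronglyMeasurable,
      h1 θ hθm h.integrable, h1 (-θ) hθm.neg h.integrable.neg, intervalIntegral]
    have h2 : ∫ r in Ioc s t, e (F r) * θ r ∂μ = ∫ r in Ioc s t, max (θ r) 0 * e (F r) ∂μ -
        ∫ r in Ioc s t, max ((-θ) r) 0 * e (F r) ∂μ := by
      have h3 : ∀ d : ℝ → ℝ, Integrable d μ →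
          Integrable (fun r => max (d r) 0 * e (F r)) (μ.restrict (Ioc s t)) := fun d hd =>
        hd.pos_part.integrableOn.mul_bdd (c := B) (he.comp hFc.measurable).aestronglyMeasurable
          (Eventually.of_forall fun r => hB _)
      rw [← integral_sub (h3 _ h.integrable) (h3 _ h.integrable.neg)]
      refine integral_congr_ae (Eventually.of_forall fun r => ?_)
      simp only [Pi.neg_apply]
      rcases le_total 0 (θ r) with h0 | h0
      · rw [max_eq_left h0, max_eq_right (neg_nonpos.2 h0)]; ring
      · rw [max_eq_right h0, max_eq_left (neg_nonneg.2 h0)]; ring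
    rw [h2]; ring
  -- It suffices to test on bounded continuous e, where the identity is the C¹ chain rule for a
  -- primitive of e.
  have hP : P₁ = P₂ := by
    refine ext_of_forall_integral_eq_of_IsFiniteMeasure fun e => ?_
    have hec : Continuous e := e.continuous
    have hprim : ∀ y, HasDerivAt (fun y => ∫ z in (0 : ℝ)..y, e z) (e y) y := fun y =>
      intervalIntegral.integral_hasDerivAt_right (hec.intervalIntegrable _ _)
        hec.aestronglyMeasurable.stronglyMeasurableAtFilter hec.continuousAt
    have := (h.comp_contDiff hprim hec).sub_eq s t hst
    rw [intervalIntegral.integral_interval_sub_left (hec.intervalIntegrable _ _)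
      (hec.intervalIntegrable _ _)] at this
    rw [← sub_eq_zero, hdiff e hec.measurable ‖e‖ (fun y => e.norm_coe_le_norm y), this, sub_self]
  have := hdiff η hη C hC
  rw [hP, sub_self] at this
  linarith

/-- A density of `F` vanishes almost everywhere on the preimage of a Lebesgue null set. -/
theorem ae_eq_zero_of_volume_zero [IsFiniteMeasure μ] [NullSingletonClass μ]
    (h : HasDensity μ F θ) {N : Set ℝ} (hN : volume N = 0) :
    ∀ᵐ r ∂μ, F r ∈ N → θ r = 0 := by
  wlog hm : MeasurableSet N generalizing N
  · filter_upwards [this (N := toMeasurable volume N) (by simpa using hN)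
      (measurableSet_toMeasurable _ _)] with r hr h'
    exact hr (subset_toMeasurable _ _ h')
  have hη : Measurable (N.indicator (1 : ℝ → ℝ)) := measurable_one.indicator hm
  have hb : ∀ y, |N.indicator (1 : ℝ → ℝ) y| ≤ 1 := fun y => by
    by_cases hy : y ∈ N <;> simp [hy]
  -- By the change of variables the indicator of N composed with F, times θ, is a density of the
  -- zero function, so uniqueness of densities makes it vanish.
  have h0 : HasDensity μ (fun _ => 0) (fun r => N.indicator (1 : ℝ → ℝ) (F r) * θ r) := by
    refine ⟨h.integrable.bdd_mul (c := 1) (hη.comp h.continuous.measurable).aestronglyMeasurable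
      (Eventually.of_forall fun r => hb _), fun s t hst => ?_⟩
    rw [← h.integral_comp_mul hη hb hst, sub_self, eq_comm]
    refine intervalIntegral.integral_zero_ae ?_
    have : ∀ᵐ y, y ∉ N := measure_eq_zero_iff_ae_notMem.1 hN
    filter_upwards [this] with y hy _ using by simp [hy]
  have h0' : HasDensity μ (fun _ => 0) (fun _ => 0) := ⟨by simp, by simp⟩
  filter_upwards [h0.ae_eq h0'] with r hr hrN
  simpa [hrN] using hr

/-- The chain rule for Lipschitz outer functions. -/
theorem comp_lipschitz [IsFiniteMeasure μ] [NullSingletonClass μ] (h : HasDensity μ F θ)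
    {φ : ℝ → ℝ} {L : NNReal} (hφ : LipschitzWith L φ) :
    HasDensity μ (fun t => φ (F t)) (fun t => deriv φ (F t) * θ t) := by
  have hb : ∀ y, |deriv φ y| ≤ L := fun y => norm_deriv_le_of_lipschitz hφ
  refine ⟨h.integrable.bdd_mul (c := L)
    ((measurable_deriv φ).comp h.continuous.measurable).aestronglyMeasurable
    (Eventually.of_forall fun r => hb _), fun s t hst => ?_⟩
  -- With η = φ', the change of variables leaves the fundamental theorem of calculus for φ. The
  -- value 0 of `deriv` where φ is not differentiable does no harm.
  rw [← h.integral_comp_mul (measurable_deriv φ) hb hst]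
  exact (hφ.lipschitzOnWith.absolutelyContinuousOnInterval.integral_deriv_eq_sub).symm

end HasDensity

/-! ### Arc length measures and subcurves -/

namespace PathCurve

section Curves

variable {X : Type*} [MetricSpace X]

theorem ext_apply_of_mem (γ : PathCurve X) {t : ℝ} (ht : t ∈ Icc γ.a γ.b) :
    γ.ext t = γ.toMap ⟨t, ht⟩ := IccExtend_of_mem _ _ ht

theorem ext_a (γ : PathCurve X) : γ.ext γ.a = γ.source := IccExtend_left _ _

theorem ext_b (γ : PathCurve X) : γ.ext γ.b = γ.target := IccExtend_right _ _

theorem ext_of_le_a (γ : PathCurve X) {t : ℝ} (ht : t ≤ γ.a) : γ.ext t = γ.source :=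
  IccExtend_of_le_left _ _ ht

theorem ext_of_b_le (γ : PathCurve X) {t : ℝ} (ht : γ.b ≤ t) : γ.ext t = γ.target :=
  IccExtend_of_right_le _ _ ht

theorem Nonconstant.exists_ext_ne {γ : PathCurve X} (h : γ.Nonconstant) (t : ℝ) :
    ∃ u, γ.ext u ≠ γ.ext t := by
  obtain ⟨r, s, hrs⟩ := h
  by_contra! hc
  refine hrs ?_
  have hr := hc r
  have hs := hc s
  rw [γ.ext_apply_of_mem r.2] at hr
  rw [γ.ext_apply_of_mem s.2] at hs
  exact hr.trans hs.symm

variable {γ : PathCurve X}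

theorem arcLength_sub (h : γ.Rectifiable) (s t : ℝ) :
    γ.arcLength h t - γ.arcLength h s = variationOnFromTo γ.ext univ s t :=
  variationOnFromTo.sub_right h.boundedVariationOn_ext.locallyBoundedVariationOn
    (mem_univ _) (mem_univ _) (mem_univ _)

theorem lengthMeasure_Ioc (h : γ.Rectifiable) {s t : ℝ} (hst : s ≤ t) :
    γ.lengthMeasure h (Ioc s t) = eVariationOn γ.ext (Icc s t) := by
  rw [lengthMeasure, StieltjesFunction.measure_Ioc, arcLength_sub,
    variationOnFromTo.eq_of_le _ _ hst, univ_inter,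
    ENNReal.ofReal_toReal (h.boundedVariationOn_ext.mono (subset_univ _))]

theorem isFiniteMeasure_lengthMeasure (h : γ.Rectifiable) :
    IsFiniteMeasure (γ.lengthMeasure h) :=
  StieltjesFunction.isFiniteMeasure_of_forall_abs_le _
    fun _ => variationOnFromTo.abs_le_eVariationOn h.boundedVariationOn_ext

/-- The arc length function has no jumps because γ is continuous. -/
theorem nullSingletonClass_lengthMeasure (h : γ.Rectifiable) :
    NullSingletonClass (γ.lengthMeasure h) := by
  refine ⟨fun x => ?_⟩
  have hc : Tendsto (γ.arcLength h) (𝓝[<] x) (𝓝 (γ.arcLength h x)) := by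
    have := variationOnFromTo.tendsto_left (f := γ.ext) (l := γ.ext x) (mem_univ γ.a) (mem_univ x)
      h.boundedVariationOn_ext.locallyBoundedVariationOn
    simp only [univ_inter, dist_self, sub_zero] at this
    exact this (γ.continuous_ext.continuousWithinAt.tendsto)
  rw [lengthMeasure, StieltjesFunction.measure_singleton, leftLim_eq_of_tendsto hc]
  simp

/-- The extension of γ is constant outside [a, b]. Path integrals may therefore be taken over the
whole line. -/
theorem lengthMeasure_compl (h : γ.Rectifiable) : γ.lengthMeasure h (Icc γ.a γ.b)ᶜ = 0 := by
  have hl : γ.lengthMeasure h (Iio γ.a) = 0 := by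
    have : Iio γ.a ⊆ ⋃ n : ℕ, Ioc (γ.a - n) γ.a := fun t ht => by
      obtain ⟨n, hn⟩ := exists_nat_gt (γ.a - t)
      exact mem_iUnion.2 ⟨n, by simp only [mem_Ioc]; constructor <;> [linarith; exact le_of_lt ht]⟩
    refine measure_mono_null this (measure_iUnion_null fun n => ?_)
    rw [lengthMeasure_Ioc h (by simp)]
    refine eVariationOn.constant_on ?_
    rintro _ ⟨x, hx, rfl⟩ _ ⟨y, hy, rfl⟩
    rw [γ.ext_of_le_a hx.2, γ.ext_of_le_a hy.2]
  have hr : γ.lengthMeasure h (Ioi γ.b) = 0 := by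
    have : Ioi γ.b ⊆ ⋃ n : ℕ, Ioc γ.b (γ.b + n) := fun t ht => by
      obtain ⟨n, hn⟩ := exists_nat_gt (t - γ.b)
      exact mem_iUnion.2 ⟨n, by simp only [mem_Ioc]; constructor <;> [exact ht; linarith]⟩
    refine measure_mono_null this (measure_iUnion_null fun n => ?_)
    rw [lengthMeasure_Ioc h (by simp)]
    refine eVariationOn.constant_on ?_
    rintro _ ⟨x, hx, rfl⟩ _ ⟨y, hy, rfl⟩
    rw [γ.ext_of_b_le hx.1, γ.ext_of_b_le hy.1]
  refine measure_mono_null (fun t ht => ?_) (measure_union_null hl hr)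
  rcases lt_or_ge t γ.a with h1 | h1
  · exact .inl h1
  · exact .inr (lt_of_not_ge fun h2 => ht ⟨h1, h2⟩)

theorem pathIntegral_eq (h : γ.Rectifiable) (ρ : X → ℝ≥0∞) :
    γ.pathIntegral ρ = ∫⁻ t, ρ (γ.ext t) ∂(γ.lengthMeasure h) := by
  rw [pathIntegral, dif_pos h, Measure.restrict_eq_self_of_ae_mem]
  exact lengthMeasure_compl h

theorem pathIntegral_mono {ρ ρ' : X → ℝ≥0∞} (hle : ρ ≤ ρ') :
    γ.pathIntegral ρ ≤ γ.pathIntegral ρ' := by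
  unfold pathIntegral
  split_ifs
  · exact lintegral_mono fun t => hle _
  · exact le_rfl

/-- The restriction of (the extension of) `γ` to `[s, t]`. -/
noncomputable def subcurve (γ : PathCurve X) {s t : ℝ} (hst : s < t) : PathCurve X :=
  ⟨s, t, hst, ⟨fun r => γ.ext r, γ.continuous_ext.comp continuous_subtype_val⟩⟩

theorem source_subcurve {s t : ℝ} (hst : s < t) : (γ.subcurve hst).source = γ.ext s := rfl

theorem target_subcurve {s t : ℝ} (hst : s < t) : (γ.subcurve hst).target = γ.ext t := rfl

theorem nonconstant_subcurve {s t : ℝ} (hst : s < t) (h : γ.ext s ≠ γ.ext t) :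
    (γ.subcurve hst).Nonconstant :=
  ⟨⟨s, left_mem_Icc.2 hst.le⟩, ⟨t, right_mem_Icc.2 hst.le⟩, h⟩

theorem ext_subcurve {s t : ℝ} (hst : s < t) {r : ℝ} (hr : r ∈ Icc s t) :
    (γ.subcurve hst).ext r = γ.ext r := ext_apply_of_mem (γ.subcurve hst) hr

theorem Rectifiable.subcurve (h : γ.Rectifiable) {s t : ℝ} (hst : s < t) :
    (γ.subcurve hst).Rectifiable :=
  ne_top_of_le_ne_top h.boundedVariationOn_ext
    (eVariationOn.comp_le_of_monotoneOn γ.ext (t := univ) (s := univ)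
      (Subtype.val : Icc s t → ℝ) (Subtype.mono_coe _ |>.monotoneOn _) (mapsTo_univ _ _))

/-- On subintervals of (s, t] both measures give the variation of the same map. Inequalities along
all subcurves thus become inequalities in the single measure of γ. -/
theorem restrict_lengthMeasure_subcurve (h : γ.Rectifiable) {s t : ℝ} (hst : s < t) :
    ((γ.subcurve hst).lengthMeasure (h.subcurve hst)).restrict (Ioc s t) =
      (γ.lengthMeasure h).restrict (Ioc s t) := by
  have := isFiniteMeasure_lengthMeasure (h.subcurve hst)
  refine Measure.ext_of_Ioc _ _ fun u v _ => ?_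
  rw [Measure.restrict_apply measurableSet_Ioc, Measure.restrict_apply measurableSet_Ioc,
    Ioc_inter_Ioc]
  rcases le_total (min v t) (max u s) with hle | hle
  · rw [Ioc_eq_empty_of_le hle, measure_empty, measure_empty]
  · rw [lengthMeasure_Ioc _ hle, lengthMeasure_Ioc _ hle]
    refine eVariationOn.congr fun r hr => ext_subcurve hst ⟨?_, ?_⟩
    · exact (le_max_right _ _).trans hr.1
    · exact hr.2.trans (min_le_right _ _)

theorem pathIntegral_subcurve (h : γ.Rectifiable) {s t : ℝ} (hst : s < t) (ρ : X → ℝ≥0∞) :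
    (γ.subcurve hst).pathIntegral ρ = ∫⁻ r in Ioc s t, ρ (γ.ext r) ∂(γ.lengthMeasure h) := by
  have := nullSingletonClass_lengthMeasure (h.subcurve hst)
  rw [pathIntegral, dif_pos (h.subcurve hst), ← restrict_lengthMeasure_subcurve h hst]
  change ∫⁻ r in Icc s t, _ ∂_ = _
  rw [← restrict_Ioc_eq_restrict_Icc]
  refine setLIntegral_congr_fun measurableSet_Ioc fun r hr => ?_
  simp only [ext_subcurve hst (Ioc_subset_Icc_self hr)]

theorem pathIntegral_subcurve_le (h : γ.Rectifiable) {s t : ℝ} (hst : s < t) (ρ : X → ℝ≥0∞) :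
    (γ.subcurve hst).pathIntegral ρ ≤ γ.pathIntegral ρ := by
  rw [pathIntegral_subcurve h, pathIntegral_eq h]
  exact setLIntegral_le_lintegral _ _

variable [MeasurableSpace X] [BorelSpace X]

theorem measurable_ext (γ : PathCurve X) : Measurable γ.ext := γ.continuous_ext.measurable

theorem const_mul_pathIntegral {ρ : X → ℝ≥0∞} (hρ : Measurable ρ) {c : ℝ≥0∞} (hc : c ≠ 0) :
    c * γ.pathIntegral ρ = γ.pathIntegral (fun x => c * ρ x) := by
  unfold pathIntegral
  split_ifs
  · exact (lintegral_const_mul c (hρ.comp γ.measurable_ext)).symm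
  · exact ENNReal.mul_top hc

end Curves

end PathCurve

/-! ### Modulus and properties of almost every curve -/

section Modulus

variable {X : Type*} [MetricSpace X] [MeasurableSpace X] {m : Measure X} {p : ℝ}
  {P Q : PathCurve X → Prop}

theorem ForModAECurve.mono (hP : ForModAECurve m p P)
    (h : ∀ γ : PathCurve X, γ.Rectifiable → γ.Nonconstant → P γ → Q γ) : ForModAECurve m p Q := by
  refine le_antisymm ?_ bot_le
  rw [← show pModulus m p _ = 0 from hP]
  refine le_iInf₂ fun ρ hρ => iInf₂_le ρ ⟨hρ.1, fun γ hγ => hρ.2 γ ⟨hγ.1, hγ.2.1, fun hPγ => ?_⟩⟩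
  exact hγ.2.2 (h γ hγ.1 hγ.2.1 hPγ)

variable [BorelSpace X]

/-- A property of almost every curve holds along each curve on which the path integral of a
suitable function of arbitrarily small norm is finite. -/
theorem ForModAECurve.exists_function (hp : 1 ≤ p) (hP : ForModAECurve m p P) {ε : ℝ≥0∞}
    (hε : ε ≠ 0) :
    ∃ h : X → ℝ≥0∞, Measurable h ∧ ∫⁻ x, h x ^ p ∂m ≤ ε ∧
      ∀ γ : PathCurve X, γ.Rectifiable → γ.Nonconstant → γ.pathIntegral h ≠ ∞ → P γ := by
  have hp0 : 0 < p := by linarith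
  obtain ⟨δ, hδ, hδsum⟩ := ENNReal.exists_pos_sum_of_countable' hε ℕ
  have hex : ∀ n : ℕ, ∃ ρ, IsAdmissible {γ : PathCurve X | γ.Rectifiable ∧ γ.Nonconstant ∧ ¬ P γ} ρ ∧
      ∫⁻ x, ((2 : ℝ≥0∞) ^ n * ρ x) ^ p ∂m ≤ δ n := by
    intro n
    have hc : ((2 : ℝ≥0∞) ^ n) ^ p ≠ ∞ := by finiteness
    have hc0 : ((2 : ℝ≥0∞) ^ n) ^ p ≠ 0 := by
      simp [ENNReal.rpow_eq_zero_iff]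
    have hlt : pModulus m p {γ : PathCurve X | γ.Rectifiable ∧ γ.Nonconstant ∧ ¬ P γ} <
        δ n / ((2 : ℝ≥0∞) ^ n) ^ p := by
      rw [show pModulus m p _ = 0 from hP]
      exact ENNReal.div_pos (hδ n).ne' hc
    simp only [pModulus, iInf_lt_iff] at hlt
    obtain ⟨ρ, hρ, hlt⟩ := hlt
    refine ⟨ρ, hρ, ?_⟩
    simp_rw [ENNReal.mul_rpow_of_nonneg _ _ hp0.le]
    rw [lintegral_const_mul _ (hρ.1.pow_const p), mul_comm]
    exact (ENNReal.le_div_iff_mul_le (.inl hc0) (.inl hc)).1 hlt.le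
  choose ρ hρ hint using hex
  have hmeas : ∀ n, Measurable fun x => (2 : ℝ≥0∞) ^ n * ρ n x := fun n => (hρ n).1.const_mul _
  -- Along a bad curve each ρ n has integral at least 1, so the supremum of the 2ⁿ ρ n has infinite
  -- integral. Its p-th power is at most the sum of the p-th powers, which avoids Minkowski's
  -- inequality.
  refine ⟨fun x => ⨆ n, (2 : ℝ≥0∞) ^ n * ρ n x, .iSup hmeas, ?_, fun γ h hnc hfin => ?_⟩
  · calc ∫⁻ x, (⨆ n, (2 : ℝ≥0∞) ^ n * ρ n x) ^ p ∂m
        ≤ ∫⁻ x, ∑' n, ((2 : ℝ≥0∞) ^ n * ρ n x) ^ p ∂m := by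
          refine lintegral_mono fun x => ?_
          rw [← ENNReal.le_rpow_inv_iff hp0]
          refine iSup_le fun n => ?_
          rw [ENNReal.le_rpow_inv_iff hp0]
          exact ENNReal.le_tsum n
      _ = ∑' n, ∫⁻ x, ((2 : ℝ≥0∞) ^ n * ρ n x) ^ p ∂m :=
          lintegral_tsum fun n => ((hmeas n).pow_const p).aemeasurable
      _ ≤ ∑' n, δ n := ENNReal.tsum_le_tsum hint
      _ ≤ ε := hδsum.le
  · by_contra hPγ
    refine hfin (top_unique ?_)
    refine le_of_tendsto' (ENNReal.tendsto_pow_atTop_nhds_top_iff.2 (by norm_num : (1 : ℝ≥0∞) < 2))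
      fun n => ?_
    calc (2 : ℝ≥0∞) ^ n = 2 ^ n * 1 := (mul_one _).symm
      _ ≤ 2 ^ n * γ.pathIntegral (ρ n) := by gcongr; exact (hρ n).2 γ ⟨h, hnc, hPγ⟩
      _ = γ.pathIntegral (fun x => 2 ^ n * ρ n x) :=
          PathCurve.const_mul_pathIntegral (hρ n).1 (by simp)
      _ ≤ _ := PathCurve.pathIntegral_mono fun x => le_iSup (fun n => (2 : ℝ≥0∞) ^ n * ρ n x) n

/-- A converse to `ForModAECurve.exists_function`: since h has infinite integral along every bad
curve, each multiple c h with c ≠ 0 is admissible, and c may be taken arbitrarily small. -/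
theorem forModAECurve_of_function (hp : 1 ≤ p) {h : X → ℝ≥0∞} (hm : Measurable h)
    (hfin : ∫⁻ x, h x ^ p ∂m ≠ ∞)
    (hP : ∀ γ : PathCurve X, γ.Rectifiable → γ.Nonconstant → γ.pathIntegral h ≠ ∞ → P γ) :
    ForModAECurve m p P := by
  have hp0 : 0 < p := by linarith
  refine le_antisymm (le_of_forall_gt fun ε hε => ?_) bot_le
  obtain ⟨c, hc0, hc⟩ : ∃ c : ℝ≥0∞, c ≠ 0 ∧ c ^ p * ∫⁻ x, h x ^ p ∂m < ε := by
    obtain ⟨d, hd0, hd⟩ := ENNReal.exists_pos_mul_lt hfin hε.ne'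
    refine ⟨d ^ p⁻¹, by simp [ENNReal.rpow_eq_zero_iff, hd0.ne', hp0, hp0.le, not_lt.2], ?_⟩
    rwa [ENNReal.rpow_inv_rpow hp0.ne']
  refine lt_of_le_of_lt (iInf₂_le (fun x => c * h x) ⟨hm.const_mul c, ?_⟩) ?_
  · simp only [ENNReal.mul_rpow_of_nonneg _ _ hp0.le]
    rwa [lintegral_const_mul _ (hm.pow_const p)]
  · rintro γ ⟨hr, hnc, hPγ⟩
    have : γ.pathIntegral h = ∞ := by
      by_contra hne
      exact hPγ (hP γ hr hnc hne)
    rw [← PathCurve.const_mul_pathIntegral hm hc0, this, ENNReal.mul_top hc0]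
    exact le_top

theorem ForModAECurve.all (hp : 1 ≤ p) {P : ℕ → PathCurve X → Prop}
    (hP : ∀ n, ForModAECurve m p (P n)) : ForModAECurve m p fun γ => ∀ n, P n γ := by
  have hp0 : 0 < p := by linarith
  obtain ⟨δ, hδ, hδsum⟩ := ENNReal.exists_pos_sum_of_countable' one_ne_zero ℕ
  choose h hmeas hint hh using fun n => (hP n).exists_function hp (hδ n).ne'
  refine forModAECurve_of_function hp (h := fun x => ⨆ n, h n x) (.iSup hmeas) ?_
    fun γ hr hnc hfin n => hh n γ hr hnc (ne_top_of_le_ne_top hfin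
      (PathCurve.pathIntegral_mono fun x => le_iSup (fun n => h n x) n))
  refine ne_top_of_le_ne_top ENNReal.one_ne_top ?_
  calc ∫⁻ x, (⨆ n, h n x) ^ p ∂m
      ≤ ∫⁻ x, ∑' n, h n x ^ p ∂m := by
        refine lintegral_mono fun x => ?_
        rw [← ENNReal.le_rpow_inv_iff hp0]
        refine iSup_le fun n => ?_
        rw [ENNReal.le_rpow_inv_iff hp0]
        exact ENNReal.le_tsum n
    _ = ∑' n, ∫⁻ x, h n x ^ p ∂m := lintegral_tsum fun n => ((hmeas n).pow_const p).aemeasurable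
    _ ≤ ∑' n, δ n := ENNReal.tsum_le_tsum hint
    _ ≤ 1 := hδsum.le

theorem ForModAECurve.and (hp : 1 ≤ p) (hP : ForModAECurve m p P) (hQ : ForModAECurve m p Q) :
    ForModAECurve m p fun γ => P γ ∧ Q γ :=
  (ForModAECurve.all hp (P := fun n => if n = 0 then P else Q)
    fun n => by by_cases hn : n = 0 <;> simpa [hn]).mono
    fun _ _ _ h => ⟨by simpa using h 0, by simpa using h 1⟩

/-- A function detecting the bad curves has no larger integral along a subcurve than along the curve
itself, so finiteness passes down to all subcurves at once. -/
theorem ForModAECurve.subcurve (hp : 1 ≤ p) (hP : ForModAECurve m p P) :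
    ForModAECurve m p fun γ => ∀ s t (hst : s < t), (γ.subcurve hst).Nonconstant →
      P (γ.subcurve hst) := by
  obtain ⟨h, hm, hint, hh⟩ := hP.exists_function hp one_ne_zero
  refine forModAECurve_of_function hp hm (ne_top_of_le_ne_top ENNReal.one_ne_top hint)
    fun γ hr _ hfin s t hst hnc => hh _ (hr.subcurve hst) hnc ?_
  exact ne_top_of_le_ne_top hfin (PathCurve.pathIntegral_subcurve_le hr hst h)

theorem forModAECurve_pathIntegral_ne_top (hp : 1 ≤ p) {ρ : X → ℝ≥0∞} (hm : Measurable ρ)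
    (hfin : ∫⁻ x, ρ x ^ p ∂m ≠ ∞) : ForModAECurve m p fun γ => γ.pathIntegral ρ ≠ ∞ :=
  forModAECurve_of_function hp hm hfin fun _ _ _ h => h

/-- Almost every curve spends no length in a given null set. -/
theorem forModAECurve_of_ae (hp : 1 ≤ p) {q : X → Prop} (hq : ∀ᵐ x ∂m, q x) :
    ForModAECurve m p fun γ => ∀ h : γ.Rectifiable, ∀ᵐ t ∂(γ.lengthMeasure h), q (γ.ext t) := by
  have hp0 : 0 < p := by linarith
  set N := toMeasurable m {x | ¬ q x}
  have hN : m N = 0 := by rw [measure_toMeasurable]; exact hq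
  -- The test function is ∞ on N and 0 elsewhere: its p-norm is 0, and a finite integral along γ
  -- forces γ to spend no length in N.
  have hNm : MeasurableSet N := measurableSet_toMeasurable _ _
  have hm : Measurable (N.indicator fun _ => (∞ : ℝ≥0∞)) := measurable_const.indicator hNm
  refine (forModAECurve_pathIntegral_ne_top hp hm ?_).mono fun γ _ _ hfin h => ?_
  · have : ∫⁻ x, N.indicator (fun _ => (∞ : ℝ≥0∞)) x ^ p ∂m = 0 := by
      rw [lintegral_eq_zero_iff (hm.pow_const p)]
      have : ∀ᵐ x ∂m, x ∉ N := measure_eq_zero_iff_ae_notMem.1 hN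
      filter_upwards [this] with x hx
      simp [hx, hp0]
    rw [this]; exact ENNReal.zero_ne_top
  · rw [PathCurve.pathIntegral_eq h] at hfin
    filter_upwards [ae_lt_top (hm.comp γ.measurable_ext) hfin] with t ht
    by_contra hqt
    have : γ.ext t ∈ N := subset_toMeasurable _ _ hqt
    simp [this] at ht

end Modulus

/-! ### Extended real values and the slope -/

theorem EReal.abs_lt_top_iff {y : EReal} : y.abs < ∞ ↔ ∃ r : ℝ, y = r := by
  induction y with
  | bot => simp
  | top => simp
  | coe r => simp [EReal.abs_coe_lt_top]

theorem EReal.ofReal_abs_toReal {y : EReal} (hy : y.abs < ∞) : ENNReal.ofReal |y.toReal| = y.abs := by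
  obtain ⟨r, rfl⟩ := EReal.abs_lt_top_iff.1 hy
  rw [EReal.toReal_coe, EReal.abs_def]

theorem lipSlope_eq_of_differentiableAt {φ : ℝ → ℝ} {t : ℝ} (h : DifferentiableAt ℝ φ t) :
    lipSlope φ t = ENNReal.ofReal |deriv φ t| := by
  have h1 := (hasDerivAt_iff_tendsto_slope.1 h.hasDerivAt).enorm
  rw [Real.enorm_eq_ofReal_abs] at h1
  refine Tendsto.limsup_eq (h1.congr' ?_)
  filter_upwards [self_mem_nhdsWithin] with s hs
  have hs' : s - t ≠ 0 := sub_ne_zero.2 hs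
  rw [slope_def_field, edist_comm (φ t), edist_comm t, edist_dist, edist_dist, Real.dist_eq,
    Real.dist_eq, Real.enorm_eq_ofReal_abs, abs_div,
    ENNReal.ofReal_div_of_pos (abs_pos.2 hs')]

theorem abs_extendZero_lt_top (φ : ℝ → ℝ) (y : EReal) : (extendZero φ y).abs < ∞ := by
  unfold extendZero
  split_ifs
  · simp
  · exact EReal.abs_coe_lt_top _

theorem toReal_extendZero (φ : ℝ → ℝ) {y : EReal} (hy : y.abs < ∞) :
    (extendZero φ y).toReal = φ y.toReal := by
  obtain ⟨r, rfl⟩ := EReal.abs_lt_top_iff.1 hy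
  simp [extendZero]

theorem abs_lt_top_and_toReal_eq_sub {X : Type*} {f g h : X → EReal}
    (hh : ∀ x, ¬ ((f x).abs = ∞ ∧ f x = g x) →
    h x = f x - g x) {x : X} (hf : (f x).abs < ∞) (hg : (g x).abs < ∞) :
    (h x).abs < ∞ ∧ (h x).toReal = (f x).toReal - (g x).toReal := by
  rw [hh x fun hc => hf.ne hc.1]
  obtain ⟨r, hr⟩ := EReal.abs_lt_top_iff.1 hf
  obtain ⟨s, hs⟩ := EReal.abs_lt_top_iff.1 hg
  rw [hr, hs, ← EReal.coe_sub]
  exact ⟨EReal.abs_coe_lt_top _, rfl⟩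

/-! ### Derivatives along curves and weak upper gradients -/

section Gradients

variable {X : Type*} [MetricSpace X]

/-- `f` is finite along `γ`, and its restriction to `γ` is absolutely continuous with respect to
arc length, with derivative bounded by `σ`. -/
def AdmitsGradient (f : X → EReal) (σ : X → ℝ≥0∞) (γ : PathCurve X) : Prop :=
  ∀ h : γ.Rectifiable, (∀ t, (f (γ.ext t)).abs < ∞) ∧
    ∃ θ, HasDensity (γ.lengthMeasure h) (fun t => (f (γ.ext t)).toReal) θ ∧
      ∀ᵐ t ∂(γ.lengthMeasure h), ENNReal.ofReal |θ t| ≤ σ (γ.ext t)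

/-- Every derivative of `f` along `γ` is bounded by `σ`. -/
def DerivBound (f : X → EReal) (σ : X → ℝ≥0∞) (γ : PathCurve X) : Prop :=
  ∀ (h : γ.Rectifiable) (θ : ℝ → ℝ),
    HasDensity (γ.lengthMeasure h) (fun t => (f (γ.ext t)).toReal) θ →
      ∀ᵐ t ∂(γ.lengthMeasure h), ENNReal.ofReal |θ t| ≤ σ (γ.ext t)

variable {f g : X → EReal} {ρ σ ρ₁ ρ₂ : X → ℝ≥0∞} {γ : PathCurve X}

/-- Uniqueness of densities turns a bound on some derivative into a bound on every derivative.
Bounds from different sources can then be compared on one θ. -/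
theorem AdmitsGradient.derivBound (h : AdmitsGradient f σ γ) : DerivBound f σ γ := by
  intro hr θ hθ
  obtain ⟨-, ϑ, hϑ, hb⟩ := h hr
  have := PathCurve.isFiniteMeasure_lengthMeasure hr
  filter_upwards [hb, hθ.ae_eq hϑ] with t ht ht'
  rwa [ht']

theorem AdmitsGradient.of_derivBound (h : AdmitsGradient f σ γ) (hb : DerivBound f ρ γ) :
    AdmitsGradient f ρ γ := fun hr =>
  let ⟨hfin, θ, hθ, _⟩ := h hr
  ⟨hfin, θ, hθ, hb hr θ hθ⟩

theorem AdmitsGradient.extendZero_comp {φ : ℝ → ℝ} {L : NNReal} (hφ : LipschitzWith L φ)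
    (h : AdmitsGradient f ρ γ) : AdmitsGradient (fun x => extendZero φ (f x))
      (fun x => ENNReal.ofReal |deriv φ (f x).toReal| * ρ x) γ := by
  intro hr
  obtain ⟨hfin, θ, hθ, hb⟩ := h hr
  have := PathCurve.isFiniteMeasure_lengthMeasure hr
  have := PathCurve.nullSingletonClass_lengthMeasure hr
  refine ⟨fun t => abs_extendZero_lt_top _ _,
    fun t => deriv φ (f (γ.ext t)).toReal * θ t, ?_, ?_⟩
  · simp only [toReal_extendZero φ (hfin _)]
    exact hθ.comp_lipschitz hφ
  · filter_upwards [hb] with t ht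
    rw [abs_mul, ENNReal.ofReal_mul (abs_nonneg _)]
    gcongr

theorem AdmitsGradient.mul (hf : AdmitsGradient f ρ₁ γ) (hg : AdmitsGradient g ρ₂ γ) :
    AdmitsGradient (fun x => f x * g x) (fun x => (f x).abs * ρ₂ x + (g x).abs * ρ₁ x) γ := by
  intro hr
  obtain ⟨hfin₁, θ₁, hθ₁, hb₁⟩ := hf hr
  obtain ⟨hfin₂, θ₂, hθ₂, hb₂⟩ := hg hr
  have := PathCurve.isFiniteMeasure_lengthMeasure hr
  have := PathCurve.nullSingletonClass_lengthMeasure hr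
  refine ⟨fun t => ?_,
    fun t => (f (γ.ext t)).toReal * θ₂ t + (g (γ.ext t)).toReal * θ₁ t, ?_, ?_⟩
  · simp only [EReal.abs_mul]
    exact ENNReal.mul_lt_top (hfin₁ t) (hfin₂ t)
  · simp only [EReal.toReal_mul]
    exact hθ₁.mul hθ₂
  · filter_upwards [hb₁, hb₂] with t h1 h2
    refine (ENNReal.ofReal_le_ofReal (abs_add_le _ _)).trans ?_
    rw [ENNReal.ofReal_add (abs_nonneg _) (abs_nonneg _), abs_mul, abs_mul,
      ENNReal.ofReal_mul (abs_nonneg _), ENNReal.ofReal_mul (abs_nonneg _),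
      EReal.ofReal_abs_toReal (hfin₁ t), EReal.ofReal_abs_toReal (hfin₂ t)]
    gcongr

variable [MeasurableSpace X] {m : Measure X} {p : ℝ}

theorem lintegral_add_rpow_lt_top (hp : 1 ≤ p) (h₁ : ρ₁ ∈ WUG m p f) (h₂ : ρ₂ ∈ WUG m p g) :
    ∫⁻ x, (ρ₁ x + ρ₂ x) ^ p ∂m < ∞ :=
  ENNReal.lintegral_rpow_add_lt_top_of_lintegral_rpow_lt_top h₁.1.aemeasurable h₁.2.1 h₂.2.1 hp

variable [BorelSpace X]

/-- Weak upper gradients are the functions that bound the derivative along almost every curve. -/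
theorem mem_WUG_iff (hp : 1 ≤ p) :
    ρ ∈ WUG m p f ↔ Measurable ρ ∧ ∫⁻ x, ρ x ^ p ∂m < ∞ ∧ ForModAECurve m p (AdmitsGradient f ρ) := by
  refine ⟨fun ⟨hm, hi, h1, h2⟩ => ⟨hm, hi, ?_⟩, fun ⟨hm, hi, h⟩ => ⟨hm, hi, ?_, ?_⟩⟩
  · refine (((h1.and hp h2).subcurve hp).and hp
      (forModAECurve_pathIntegral_ne_top hp hm hi.ne)).mono fun γ _ hnc ⟨hγ, hint⟩ hr => ?_
    -- Since γ is nonconstant, each t is an end of some nonconstant subcurve, and f is finite at the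
    -- end points of those.
    have hfin : ∀ t, (f (γ.ext t)).abs < ∞ := fun t => by
      obtain ⟨u, hu⟩ := hnc.exists_ext_ne t
      rcases lt_trichotomy u t with hlt | rfl | hlt
      · exact (hγ u t hlt (PathCurve.nonconstant_subcurve hlt hu)).1.2
      · exact absurd rfl hu
      · exact (hγ t u hlt (PathCurve.nonconstant_subcurve hlt hu.symm)).1.1
    have := PathCurve.isFiniteMeasure_lengthMeasure hr
    have := PathCurve.nullSingletonClass_lengthMeasure hr
    rw [PathCurve.pathIntegral_eq hr] at hint
    refine ⟨hfin, HasDensity.exists_of_le (hm.comp γ.measurable_ext) hint fun s t hst => ?_⟩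
    -- If the end points coincide the subcurve may be constant, so the hypothesis may say nothing,
    -- but then the increment is 0.
    by_cases heq : γ.ext s = γ.ext t
    · simp [heq]
    have hlt : s < t := lt_of_le_of_ne hst fun h => heq (h ▸ rfl)
    have hle := (hγ s t hlt (PathCurve.nonconstant_subcurve hlt heq)).2
    rw [PathCurve.pathIntegral_subcurve hr, PathCurve.source_subcurve,
      PathCurve.target_subcurve] at hle
    obtain ⟨x, hx⟩ := EReal.abs_lt_top_iff.1 (hfin s)
    obtain ⟨y, hy⟩ := EReal.abs_lt_top_iff.1 (hfin t)
    simp only [hx, hy, EReal.toReal_coe] at hle ⊢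
    rwa [← EReal.coe_sub, EReal.abs_def] at hle
  · refine h.mono fun γ hr _ hγ => ?_
    rw [← γ.ext_a, ← γ.ext_b]
    exact ⟨(hγ hr).1 _, (hγ hr).1 _⟩
  · refine h.mono fun γ hr _ hγ => ?_
    obtain ⟨hfin, θ, hθ, hb⟩ := hγ hr
    rw [← γ.ext_a, ← γ.ext_b, PathCurve.pathIntegral_eq hr]
    have hle := hθ.ofReal_abs_sub_le γ.lt.le
    obtain ⟨x, hx⟩ := EReal.abs_lt_top_iff.1 (hfin γ.a)
    obtain ⟨y, hy⟩ := EReal.abs_lt_top_iff.1 (hfin γ.b)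
    simp only [hx, hy, EReal.toReal_coe] at hle ⊢
    rw [← EReal.coe_sub, EReal.abs_def]
    exact hle.trans ((setLIntegral_le_lintegral _ _).trans (lintegral_mono_ae hb))

/-! ### Minimal weak upper gradients -/

/-- Off one exceptional family all the bounds hold for the same density θ, hence so does their
infimum. -/
theorem iInf_mem_WUG (hp : 1 ≤ p) {ρ : ℕ → X → ℝ≥0∞} (h : ∀ n, ρ n ∈ WUG m p f) :
    (fun x => ⨅ n, ρ n x) ∈ WUG m p f := by
  simp only [mem_WUG_iff hp] at h ⊢
  refine ⟨.iInf fun n => (h n).1, lt_of_le_of_lt (lintegral_mono fun x => ?_) (h 0).2.1, ?_⟩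
  · exact ENNReal.rpow_le_rpow (iInf_le (fun n => ρ n x) 0) (by linarith)
  · refine (ForModAECurve.all hp fun n => (h n).2.2).mono fun γ _ _ hγ =>
      (hγ 0).of_derivBound fun hr θ hθ => ?_
    filter_upwards [ae_all_iff.2 fun n => (hγ n).derivBound hr θ hθ] with t ht
    exact le_iInf ht

theorem exists_isMinimalWUG (hp : 1 ≤ p) (h : (WUG m p f).Nonempty) :
    ∃ ρ, IsMinimalWUG m p f ρ := by
  obtain ⟨u, -, hu, hmem⟩ := exists_seq_tendsto_sInf
    (h.image fun ρ => ∫⁻ x, ρ x ^ p ∂m) (OrderBot.bddBelow _)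
  choose ρ hρ hρu using hmem
  refine ⟨_, iInf_mem_WUG hp hρ, fun ρ' hρ' => ?_⟩
  refine ENNReal.rpow_le_rpow ?_ (by positivity)
  refine le_trans (ge_of_tendsto' hu fun n => ?_) (sInf_le ⟨ρ', hρ', rfl⟩)
  rw [← hρu n]
  exact lintegral_mono fun x =>
    ENNReal.rpow_le_rpow (iInf_le (fun n => ρ n x) n) (by linarith)

/-- A minimal weak upper gradient is minimal pointwise almost everywhere. -/
theorem IsMinimalWUG.ae_le (hp : 1 ≤ p) (h : IsMinimalWUG m p f ρ) (hσ : σ ∈ WUG m p f) :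
    ρ ≤ᵐ[m] σ := by
  have hp0 : 0 < p := by linarith
  -- The minimum of ρ and σ, written as a countable infimum. It lies below ρ and cannot have smaller
  -- norm, so it equals ρ a.e.
  have hinf : (fun x => ⨅ n : ℕ, (if n = 0 then ρ else σ) x) ∈ WUG m p f :=
    iInf_mem_WUG hp fun n => by by_cases hn : n = 0 <;> simp [hn, h.1, hσ]
  set τ := fun x => ⨅ n : ℕ, (if n = 0 then ρ else σ) x with hτ
  have hτρ : τ ≤ ρ := fun x => (iInf_le _ 0).trans (by simp)
  have hτσ : τ ≤ σ := fun x => (iInf_le _ 1).trans (by simp)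
  have hle := (ENNReal.rpow_le_rpow_iff (one_div_pos.2 hp0)).1 (h.2 τ hinf)
  have heq := ae_eq_of_ae_le_of_lintegral_le
    (Eventually.of_forall fun x => ENNReal.rpow_le_rpow (hτρ x) hp0.le) hinf.2.1.ne
    (h.1.1.pow_const p).aemeasurable hle
  filter_upwards [heq] with x hx
  have : τ x = ρ x := ENNReal.rpow_left_injective hp0.ne' hx
  exact this ▸ hτσ x

theorem IsMinimalWUG.ae_unique (hp : 1 ≤ p) (h : IsMinimalWUG m p f ρ)
    (h' : IsMinimalWUG m p f σ) : ρ =ᵐ[m] σ :=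
  (h.ae_le hp h'.1).antisymm (h'.ae_le hp h.1)

/-- A function that bounds the derivative along almost every curve bounds the minimal weak upper
gradient. -/
theorem IsMinimalWUG.ae_le_of_derivBound (hp : 1 ≤ p) (h : IsMinimalWUG m p f ρ)
    (hσ : AEMeasurable σ m) (hb : ForModAECurve m p (DerivBound f σ)) : ρ ≤ᵐ[m] σ := by
  have hρ := (mem_WUG_iff hp).1 h.1
  -- The minimum with ρ secures p-integrability, and a Borel version of σ may be used because almost
  -- every curve spends no length where it differs from σ.
  have hmem : (fun x => min (ρ x) (hσ.mk σ x)) ∈ WUG m p f := by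
    refine (mem_WUG_iff hp).2 ⟨hρ.1.min hσ.measurable_mk, lt_of_le_of_lt
      (lintegral_mono fun x => ENNReal.rpow_le_rpow (min_le_left _ _) (by linarith)) hρ.2.1, ?_⟩
    refine ((hρ.2.2.and hp hb).and hp (forModAECurve_of_ae hp hσ.ae_eq_mk)).mono
      fun γ _ _ hγ => hγ.1.1.of_derivBound fun hr θ hθ => ?_
    filter_upwards [hγ.1.1.derivBound hr θ hθ, hγ.1.2 hr θ hθ, hγ.2 hr] with t h1 h2 h3
    exact le_min h1 (h3 ▸ h2)
  filter_upwards [h.ae_le hp hmem, hσ.ae_eq_mk] with x hx hx'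
  rw [hx']
  exact hx.trans (min_le_right _ _)

/-- The comparison function is 0 on E and ∞ off E; it bounds θ precisely because θ vanishes where γ
is in E. -/
theorem IsMinimalWUG.ae_eq_zero (hp : 1 ≤ p) (h : IsMinimalWUG m p f ρ) {E : Set X}
    (hE : NullMeasurableSet E m)
    (hz : ForModAECurve m p fun γ => ∀ (hr : γ.Rectifiable) (θ : ℝ → ℝ),
      HasDensity (γ.lengthMeasure hr) (fun t => (f (γ.ext t)).toReal) θ →
        ∀ᵐ t ∂(γ.lengthMeasure hr), γ.ext t ∈ E → θ t = 0) :
    ∀ᵐ x ∂m, x ∈ E → ρ x = 0 := by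
  have hσ : AEMeasurable (Eᶜ.indicator fun _ => (∞ : ℝ≥0∞)) m :=
    aemeasurable_const.indicator₀ hE.compl
  filter_upwards [h.ae_le_of_derivBound hp hσ (hz.mono fun γ _ _ hγ hr θ hθ => by
    filter_upwards [hγ hr θ hθ] with t ht
    by_cases hE : γ.ext t ∈ E
    · simp [ht hE]
    · simp [hE])] with x hx hxE
  simpa [hxE] using hx

/-! ### Calculus rules for minimal weak upper gradients -/

theorem IsMinimalWUG.ae_eq_zero_of_abs_eq_top (hp : 1 ≤ p) (h : IsMinimalWUG m p f ρ)
    (hf : NullMeasurable f m) : ∀ᵐ x ∂m, (f x).abs = ∞ → ρ x = 0 := by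
  have hE : NullMeasurableSet {x | f x = ⊤ ∨ f x = ⊥} m :=
    (hf (measurableSet_singleton ⊤)).union (hf (measurableSet_singleton ⊥))
  -- Almost every curve avoids {|f| = ∞} altogether, so the condition on θ is vacuous.
  filter_upwards [h.ae_eq_zero hp hE (((mem_WUG_iff hp).1 h.1).2.2.mono fun γ _ _ hγ hr θ _ =>
    Eventually.of_forall fun t ht => by
      have := (hγ hr).1 t
      rcases ht with ht | ht <;> simp [ht] at this)] with x hx hx'
  refine hx ?_
  by_contra! hc
  lift f x to ℝ using hc with r
  simp [EReal.abs_def] at hx'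

theorem IsMinimalWUG.ae_eq_zero_of_volume_zero (hp : 1 ≤ p) (h : IsMinimalWUG m p f ρ)
    (hf : NullMeasurable f m) {N : Set ℝ} (hN : MeasurableSet N) (hN0 : volume N = 0) :
    ∀ᵐ x ∂m, (∃ r ∈ N, f x = (r : EReal)) → ρ x = 0 := by
  have hE : NullMeasurableSet {x | ∃ r ∈ N, f x = (r : EReal)} m := by
    have := hf (EReal.measurableEmbedding_coe.measurableSet_image.2 hN)
    convert this using 1
    ext x
    simp [eq_comm]
  refine h.ae_eq_zero hp hE (((mem_WUG_iff hp).1 h.1).2.2.mono fun γ _ _ _ hr θ hθ => ?_)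
  have := PathCurve.isFiniteMeasure_lengthMeasure hr
  have := PathCurve.nullSingletonClass_lengthMeasure hr
  filter_upwards [hθ.ae_eq_zero_of_volume_zero hN0] with t ht
  rintro ⟨r, hr, hfr⟩
  exact ht (by simpa [hfr] using hr)

theorem nonempty_WUG_extendZero (hp : 1 ≤ p) {φ : ℝ → ℝ} {L : NNReal} (hφ : LipschitzWith L φ)
    (hf : (WUG m p f).Nonempty) : (WUG m p fun x => extendZero φ (f x)).Nonempty := by
  have hp0 : 0 < p := by linarith
  obtain ⟨ρ, hρ⟩ := hf
  obtain ⟨hm, hi, h⟩ := (mem_WUG_iff hp).1 hρ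
  refine ⟨fun x => L * ρ x, (mem_WUG_iff hp).2 ⟨hm.const_mul _, ?_, h.mono fun γ _ _ hγ => ?_⟩⟩
  · simp only [ENNReal.mul_rpow_of_nonneg _ _ hp0.le]
    rw [lintegral_const_mul _ (hm.pow_const p)]
    exact ENNReal.mul_lt_top (by finiteness) hi
  · refine (hγ.extendZero_comp hφ).of_derivBound fun hr θ hθ => ?_
    filter_upwards [(hγ.extendZero_comp hφ).derivBound hr θ hθ] with t ht
    refine ht.trans ?_
    gcongr
    rw [← Real.enorm_eq_ofReal_abs, ← ofReal_norm, ENNReal.ofReal_le_iff_le_toReal (by simp)]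
    exact norm_deriv_le_of_lipschitz hφ

theorem IsMinimalWUG.extendZero_comp (hp : 1 ≤ p) (hf : NullMeasurable f m) {φ : ℝ → ℝ}
    {L : NNReal} (hφ : LipschitzWith L φ) (hρ : IsMinimalWUG m p f ρ)
    (hσ : IsMinimalWUG m p (fun x => extendZero φ (f x)) σ) :
    ∀ᵐ x ∂m, ((f x).abs < ∞ → σ x = lipSlope φ (f x).toReal * ρ x) ∧
      ((f x).abs = ∞ → σ x = 0) := by
  have hfm : AEMeasurable f m := hf.aemeasurable
  set d : X → ℝ≥0∞ := fun x => ENNReal.ofReal |deriv φ (f x).toReal| with hd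
  have hdm : AEMeasurable d m := by
    have : Measurable fun y : EReal => ENNReal.ofReal |deriv φ y.toReal| :=
      (((measurable_deriv φ).comp measurable_ereal_toReal).norm).ennreal_ofReal
    exact this.comp_aemeasurable hfm
  have hρ' := ((mem_WUG_iff hp).1 hρ.1)
  have hσ' := ((mem_WUG_iff hp).1 hσ.1)
  have hle : ∀ᵐ x ∂m, σ x ≤ d x * ρ x := hσ.ae_le_of_derivBound hp
    (hdm.mul hρ'.1.aemeasurable)
    (hρ'.2.2.mono fun γ _ _ hγ => (hγ.extendZero_comp hφ).derivBound)
  -- The derivative of g along γ is φ'(f)θ and is bounded by σ, so |θ| ≤ σ/d where d ≠ 0. Where d =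
  -- 0 nothing is known, and the indicator with value ∞ makes the bound trivial (0/0 would be 0).
  have hge : ∀ᵐ x ∂m, ρ x ≤ {x | d x = 0}.indicator (fun _ => ∞) x + σ x / d x := by
    have hz : NullMeasurableSet {x | d x = 0} m := hdm.nullMeasurable (measurableSet_singleton 0)
    refine hρ.ae_le_of_derivBound hp
      ((aemeasurable_const.indicator₀ hz).add (hσ'.1.aemeasurable.div hdm)) ?_
    refine (hρ'.2.2.and hp hσ'.2.2).mono fun γ _ _ hγ hr θ hθ => ?_
    have := PathCurve.isFiniteMeasure_lengthMeasure hr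
    have := PathCurve.nullSingletonClass_lengthMeasure hr
    have hc := hθ.comp_lipschitz hφ
    have hc' : HasDensity (γ.lengthMeasure hr) (fun t => (extendZero φ (f (γ.ext t))).toReal)
        (fun t => deriv φ (f (γ.ext t)).toReal * θ t) := by
      simpa only [toReal_extendZero φ ((hγ.1 hr).1 _)] using hc
    filter_upwards [hγ.2.derivBound hr _ hc'] with t ht
    rw [abs_mul, ENNReal.ofReal_mul (abs_nonneg _)] at ht
    by_cases h0 : d (γ.ext t) = 0
    · simp [h0]
    · rw [indicator_of_notMem (by exact h0), zero_add,
        ENNReal.le_div_iff_mul_le (.inl h0) (.inl ENNReal.ofReal_ne_top), mul_comm]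
      exact ht
  -- At points of differentiability the slope is |φ'|; the remaining values form a null set, on
  -- whose preimage ρ vanishes.
  have hN0 : volume {y | ¬ DifferentiableAt ℝ φ y} = 0 := hφ.ae_differentiableAt_real
  have hNm : MeasurableSet {y | ¬ DifferentiableAt ℝ φ y} :=
    (measurableSet_of_differentiableAt ℝ φ).compl
  filter_upwards [hle, hge, hρ.ae_eq_zero_of_volume_zero hp hf hNm hN0,
    hρ.ae_eq_zero_of_abs_eq_top hp hf] with x h1 h2 h3 h4
  refine ⟨fun hx => ?_, fun hx => ?_⟩
  · obtain ⟨r, hr⟩ := EReal.abs_lt_top_iff.1 hx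
    by_cases hdiff : DifferentiableAt ℝ φ r
    · have hdx : lipSlope φ (f x).toReal = d x := by
        rw [hr, EReal.toReal_coe, lipSlope_eq_of_differentiableAt hdiff, hd]
        simp [hr]
      rw [hdx]
      refine le_antisymm h1 ?_
      by_cases h0 : d x = 0
      · simp [h0]
      · rw [indicator_of_notMem (by exact h0), zero_add,
          ENNReal.le_div_iff_mul_le (.inl h0) (.inl ENNReal.ofReal_ne_top), mul_comm] at h2
        exact h2
    · rw [h3 ⟨r, hdiff, hr⟩, mul_zero] at h1 ⊢
      exact le_antisymm h1 bot_le
  · rw [h4 hx, mul_zero] at h1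
    exact le_antisymm h1 bot_le

theorem nonempty_WUG_sub (hp : 1 ≤ p) (hf : (WUG m p f).Nonempty) (hg : (WUG m p g).Nonempty)
    {h : X → EReal} (hh : ∀ x, ¬ ((f x).abs = ∞ ∧ f x = g x) → h x = f x - g x) :
    (WUG m p h).Nonempty := by
  obtain ⟨ρ₁, h₁⟩ := hf
  obtain ⟨ρ₂, h₂⟩ := hg
  have h₁' := (mem_WUG_iff hp).1 h₁
  have h₂' := (mem_WUG_iff hp).1 h₂
  refine ⟨fun x => ρ₁ x + ρ₂ x, (mem_WUG_iff hp).2 ⟨h₁.1.add h₂.1,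
    lintegral_add_rpow_lt_top hp h₁ h₂, (h₁'.2.2.and hp h₂'.2.2).mono fun γ _ _ hγ hr => ?_⟩⟩
  obtain ⟨hfin₁, θ₁, hθ₁, hb₁⟩ := hγ.1 hr
  obtain ⟨hfin₂, θ₂, hθ₂, hb₂⟩ := hγ.2 hr
  refine ⟨fun t => (abs_lt_top_and_toReal_eq_sub hh (hfin₁ t) (hfin₂ t)).1,
    fun t => θ₁ t - θ₂ t, ?_, ?_⟩
  · simp only [fun t => (abs_lt_top_and_toReal_eq_sub hh (hfin₁ t) (hfin₂ t)).2]
    exact hθ₁.sub hθ₂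
  · filter_upwards [hb₁, hb₂] with t h1 h2
    calc ENNReal.ofReal |θ₁ t - θ₂ t| ≤ ENNReal.ofReal (|θ₁ t| + |θ₂ t|) :=
          ENNReal.ofReal_le_ofReal (abs_sub _ _)
      _ = ENNReal.ofReal |θ₁ t| + ENNReal.ofReal |θ₂ t| :=
          ENNReal.ofReal_add (abs_nonneg _) (abs_nonneg _)
      _ ≤ _ := add_le_add h1 h2

theorem IsMinimalWUG.ae_eq_zero_of_sub (hp : 1 ≤ p) (hfm : NullMeasurable f m)
    (hgm : NullMeasurable g m) (hf : (WUG m p f).Nonempty) (hg : (WUG m p g).Nonempty)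
    {h : X → EReal} (hh : ∀ x, ¬ ((f x).abs = ∞ ∧ f x = g x) → h x = f x - g x)
    (hρ : IsMinimalWUG m p h ρ) : ∀ᵐ x ∂m, f x = g x → ρ x = 0 := by
  obtain ⟨ρ₁, h₁⟩ := hf
  obtain ⟨ρ₂, h₂⟩ := hg
  have hE : NullMeasurableSet {x | f x = g x} m := nullMeasurableSet_eq_fun
    hfm.aemeasurable hgm.aemeasurable
  refine hρ.ae_eq_zero hp hE ((((mem_WUG_iff hp).1 h₁).2.2.and hp
    ((mem_WUG_iff hp).1 h₂).2.2).mono fun γ _ _ hγ hr θ hθ => ?_)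
  have := PathCurve.isFiniteMeasure_lengthMeasure hr
  have := PathCurve.nullSingletonClass_lengthMeasure hr
  -- Along γ both functions are finite, so h is 0 wherever f = g, and its derivative vanishes a.e.
  -- on the preimage of the null set {0}.
  filter_upwards [hθ.ae_eq_zero_of_volume_zero (N := {0}) (by simp)] with t ht hfg
  refine ht ?_
  have hfg' : f (γ.ext t) = g (γ.ext t) := hfg
  rw [mem_singleton_iff, (abs_lt_top_and_toReal_eq_sub hh ((hγ.1 hr).1 t) ((hγ.2 hr).1 t)).2, hfg',
    sub_self]

theorem nonempty_WUG_mul (hp : 1 ≤ p) (hf : (WUG m p f).Nonempty) (hg : (WUG m p g).Nonempty)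
    {C : ℝ} (hC : ∀ᵐ x ∂m, (f x).abs + (g x).abs ≤ ENNReal.ofReal C) :
    (WUG m p fun x => f x * g x).Nonempty := by
  have hp0 : 0 < p := by linarith
  obtain ⟨ρ₁, h₁⟩ := hf
  obtain ⟨ρ₂, h₂⟩ := hg
  have h₁' := (mem_WUG_iff hp).1 h₁
  have h₂' := (mem_WUG_iff hp).1 h₂
  refine ⟨fun x => ENNReal.ofReal C * (ρ₁ x + ρ₂ x), (mem_WUG_iff hp).2
    ⟨(h₁.1.add h₂.1).const_mul _, ?_, ((h₁'.2.2.and hp h₂'.2.2).and hp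
      (forModAECurve_of_ae hp hC)).mono fun γ _ _ hγ => ?_⟩⟩
  · simp only [ENNReal.mul_rpow_of_nonneg _ _ hp0.le]
    refine (lintegral_const_mul _ ((h₁.1.add h₂.1).pow_const p)).trans_lt ?_
    exact ENNReal.mul_lt_top (by finiteness) (lintegral_add_rpow_lt_top hp h₁ h₂)
  -- The product rule holds along the curve without boundedness. The a.e. bound C enters only to
  -- dominate |f| ρ₂ + |g| ρ₁ by a p-integrable Borel function.
  · have hmul := hγ.1.1.mul hγ.1.2
    refine hmul.of_derivBound fun hr θ hθ => ?_
    filter_upwards [hmul.derivBound hr θ hθ, hγ.2 hr] with t ht hCt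
    refine ht.trans ?_
    rw [add_comm, mul_add]
    gcongr
    · exact (self_le_add_left _ _).trans hCt
    · exact (self_le_add_right _ _).trans hCt

theorem IsMinimalWUG.mul_le (hp : 1 ≤ p) (hfm : NullMeasurable f m) (hgm : NullMeasurable g m)
    {C : ℝ} (hC : ∀ᵐ x ∂m, (f x).abs + (g x).abs ≤ ENNReal.ofReal C)
    (h₁ : IsMinimalWUG m p f ρ₁) (h₂ : IsMinimalWUG m p g ρ₂)
    (h : IsMinimalWUG m p (fun x => f x * g x) ρ) :
    ∀ᵐ x ∂m, ρ x ≤ (f x).abs * ρ₂ x + (g x).abs * ρ₁ x := by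
  have habs : ∀ {e : X → EReal}, NullMeasurable e m → (∀ᵐ x ∂m, (e x).abs < ∞) →
      AEMeasurable (fun x => (e x).abs) m := fun he hfin =>
    (he.aemeasurable.ereal_toReal.norm.ennreal_ofReal).congr (by
      filter_upwards [hfin] with x hx using EReal.ofReal_abs_toReal hx)
  have hf : AEMeasurable (fun x => (f x).abs) m := habs hfm (by
    filter_upwards [hC] with x hx
    exact ((self_le_add_right _ _).trans hx).trans_lt ENNReal.ofReal_lt_top)
  have hg : AEMeasurable (fun x => (g x).abs) m := habs hgm (by
    filter_upwards [hC] with x hx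
    exact ((self_le_add_left _ _).trans hx).trans_lt ENNReal.ofReal_lt_top)
  have h₁' := (mem_WUG_iff hp).1 h₁.1
  have h₂' := (mem_WUG_iff hp).1 h₂.1
  -- The right-hand side is only a.e. measurable, which the comparison principle allows.
  exact h.ae_le_of_derivBound hp ((hf.mul h₂'.1.aemeasurable).add (hg.mul h₁'.1.aemeasurable))
    ((h₁'.2.2.and hp h₂'.2.2).mono fun γ _ _ hγ => (hγ.1.mul hγ.2).derivBound)

end Gradients

theorem mainTheorem5 {X : Type*} [MetricSpace X] [CompleteSpace X]
    [TopologicalSpace.SeparableSpace X] [MeasurableSpace X] [BorelSpace X]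
    (m : Measure X) (hm : IsBoundedlyFiniteMeasure m) (p : ℝ) (hp : 1 ≤ p) :
    -- existence and uniqueness of the minimal `N`-weak `p`-upper gradient
    (∀ f : X → EReal, (WUG m p f).Nonempty →
      (∃ ρ, IsMinimalWUG m p f ρ) ∧
      ∀ ρ ρ', IsMinimalWUG m p f ρ → IsMinimalWUG m p f ρ' → ρ =ᵐ[m] ρ') ∧
    -- vanishing on `{|f| = ∞}` and on preimages of null sets
    (∀ f : X → EReal, NullMeasurable f m → (WUG m p f).Nonempty →
      ∀ ρf, IsMinimalWUG m p f ρf →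
        (∀ᵐ x ∂m, (f x).abs = ∞ → ρf x = 0) ∧
        ∀ N : Set ℝ, MeasurableSet N → volume N = 0 →
          ∀ᵐ x ∂m, (∃ r ∈ N, f x = (r : EReal)) → ρf x = 0) ∧
    -- chain rule for real-valued functions
    (∀ f : X → ℝ, NullMeasurable f m → (WUG m p (fun x => (f x : EReal))).Nonempty →
      ∀ φ : ℝ → ℝ, (∃ L, LipschitzWith L φ) →
        (WUG m p (fun x => (φ (f x) : EReal))).Nonempty ∧
        ∀ ρf ρg, IsMinimalWUG m p (fun x => (f x : EReal)) ρf →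
          IsMinimalWUG m p (fun x => (φ (f x) : EReal)) ρg →
          ∀ᵐ x ∂m, ρg x = lipSlope φ (f x) * ρf x) ∧
    -- chain rule for extended-real-valued functions
    (∀ f : X → EReal, NullMeasurable f m → (WUG m p f).Nonempty →
      ∀ φ : ℝ → ℝ, (∃ L, LipschitzWith L φ) →
        (WUG m p (fun x => extendZero φ (f x))).Nonempty ∧
        ∀ ρf ρg, IsMinimalWUG m p f ρf →
          IsMinimalWUG m p (fun x => extendZero φ (f x)) ρg →
          ∀ᵐ x ∂m, ((f x).abs < ∞ → ρg x = lipSlope φ (f x).toReal * ρf x) ∧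
            ((f x).abs = ∞ → ρg x = 0)) ∧
    -- locality; `h` is `f - g` with arbitrary values at the points where `f - g` has the
    -- indeterminate form `∞ - ∞`
    (∀ f g : X → EReal, NullMeasurable f m → NullMeasurable g m →
      (WUG m p f).Nonempty → (WUG m p g).Nonempty →
      ∀ h : X → EReal, (∀ x, ¬ ((f x).abs = ∞ ∧ f x = g x) → h x = f x - g x) →
        (WUG m p h).Nonempty ∧
        ∀ ρ, IsMinimalWUG m p h ρ → ∀ᵐ x ∂m, f x = g x → ρ x = 0) ∧
    -- Leibniz rule
    (∀ f g : X → EReal, NullMeasurable f m → NullMeasurable g m →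
      (WUG m p f).Nonempty → (WUG m p g).Nonempty →
      (∃ C : ℝ, ∀ᵐ x ∂m, (f x).abs + (g x).abs ≤ ENNReal.ofReal C) →
        (WUG m p (fun x => f x * g x)).Nonempty ∧
        ∀ ρf ρg ρ, IsMinimalWUG m p f ρf → IsMinimalWUG m p g ρg →
          IsMinimalWUG m p (fun x => f x * g x) ρ →
          ∀ᵐ x ∂m, ρ x ≤ (f x).abs * ρg x + (g x).abs * ρf x) := by
  refine ⟨fun f hf => ⟨exists_isMinimalWUG hp hf, fun ρ ρ' h h' => h.ae_unique hp h'⟩,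
    fun f hfm _ ρ h => ⟨h.ae_eq_zero_of_abs_eq_top hp hfm,
      fun N hN hN0 => h.ae_eq_zero_of_volume_zero hp hfm hN hN0⟩, ?_, ?_, ?_, ?_⟩
  · rintro f hfm hf φ ⟨L, hφ⟩
    have hfm' : NullMeasurable (fun x => (f x : EReal)) m :=
      measurable_coe_real_ereal.comp_nullMeasurable hfm
    have heq : (fun x => (φ (f x) : EReal)) = fun x => extendZero φ (f x : EReal) := by
      funext x; simp [extendZero]
    rw [heq]
    refine ⟨nonempty_WUG_extendZero hp hφ hf, fun ρf ρg h h' => ?_⟩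
    filter_upwards [h.extendZero_comp hp hfm' hφ h'] with x hx
    exact hx.1 (EReal.abs_coe_lt_top _)
  · rintro f hfm hf φ ⟨L, hφ⟩
    exact ⟨nonempty_WUG_extendZero hp hφ hf, fun ρf ρg h h' => h.extendZero_comp hp hfm hφ h'⟩
  · intro f g hfm hgm hf hg h hh
    exact ⟨nonempty_WUG_sub hp hf hg hh, fun ρ hρ => hρ.ae_eq_zero_of_sub hp hfm hgm hf hg hh⟩
  · rintro f g hfm hgm hf hg ⟨C, hC⟩
    exact ⟨nonempty_WUG_mul hp hf hg hC, fun ρf ρg ρ h₁ h₂ h => h₁.mul_le hp hfm hgm hC h₂ h⟩
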